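/- \textbf{Setting.} Let $\mathcal Q=\{1,\dots,N\}$ be the disjoint union of $\mathcal Q_s$ (stable modes) and $\mathcal Q_u\neq\emptyset$ (unstable modes). Let $N_0\ge 1$, $T_0\ge 0$, $\tau_d>0$, $\tau_a>1$, $T>0$, $k\ge 1$. For each $q\in\mathcal Q$ let $f_q:\mathbb R^n\times\mathbb R^m\times\mathbb R_{\ge0}\times\mathbb R_{\ge1}\to\mathbb R^n$, $(x,u,\tau,\mu)\mapsto f_q(x,u,\tau,\mu)$, be locally Lipschitz (it may be independent of $\mu$), and let $R_q:\mathbb R^n\to\mathbb R^n$ be continuous. Consider the hybrid dynamical system with state $z=(x,\tau,\rho,q,\mu)\in\mathbb R^{n+4}$ and input $u\in\mathbb R^m$ which flows, while $z\in\mathbb R^n\times[0,N_0]\times[0,T_0]\times\mathcal Q\times\mathbb R_{\ge1}$, according to $$\dot x=\mu f_q(x,u,\tau,\mu),\quad \dot\tau\in\Big[0,\tfrac{\mu}{\tau_d}\Big],\quad \dot\rho\in\Big[0,\tfrac{\mu}{\tau_a}\Big]-\mu\,\mathbb I_{\mathcal Q_u}(q),\quad \dot q=0,\quad \dot\mu=\tfrac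 kT\mu^{1+1/k},$$ and may jump, when $z\in\mathbb R^n\times[1,N_0]\times[0,T_0]\times\mathcal Q\times\mathbb R_{\ge1}$, according to $$x^+=R_q(x),\quad \tau^+=\tau-1,\quad \rho^+=\rho,\quad q^+\in\mathcal Q\setminus\{q\},\quad \mu^+=\mu .$$ Solution pairs $(z,u)$ are pairs of a hybrid arc and a hybrid input (Lebesgue measurable and locally essentially bounded in $t$ for each $j$) on a common hybrid time domain. Let $$\mathcal A=\{0\}\times[0,N_0]\times[0,T_0]\times\mathcal Q\times\mathbb R_{\ge1},$$ let $|z|_{\mathcal A}$ be the Euclidean distance to $\mathcal A$, and let $|u|_{(t,j)}$ be the supremum of $|u(t',j')|$ over the points $(t',j')\le(t,j)$ of the domain. For a solution with $\mu(0,0)=\mu_0\geq 1$, put $\Upsilon=T\mu_0^{-1/k}$ and $\mathcal T_k(t)=\int_0^t T^k(\Upsilon-s)^{-k}\,ds$ for $t\in[0,\Upsilon)$, that is, with $\mu_k(t)=T^k(\Upsilon-t)^{-k}$, $\mathcal T_k(t)=\frac{T}{k-1}\big(\mu_k(t)^{\frac{k-1}{k}}-\mu_0^{\frac{k-1}{k}}\big)$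 if $k>1$ and $\mathcal T_1(t)=T\ln(\mu_1(t)/\mu_0)$. \textbf{Stability notions.} A function $\gamma:\mathbb R_{\ge0}\to\mathbb R_{\ge0}$ is in $\mathcal K$ if it is continuous, strictly increasing and $\gamma(0)=0$. A function $\beta:\mathbb R_{\ge0}^2\to\mathbb R_{\ge0}$ is in $\mathcal{KL}$ if it is nondecreasing in its first and nonincreasing in its second argument, $\lim_{r\to0^+}\beta(r,s)=0$ for every $s$, and $\lim_{s\to\infty}\beta(r,s)=0$ for every $r$. A function $\beta:\mathbb R_{\ge0}^3\to\mathbb R_{\ge0}$ is in $\mathcal{KLL}$ if $\beta(\cdot,s,\cdot)$ and $\beta(\cdot,\cdot,s)$ are in $\mathcal{KL}$ for every $s\ge0$. The set $\mathcal A$ is PT-ISS$_{\rm F}$ if there are $\beta\in\mathcal{KLL}$ and $\gamma\in\mathcal K$ such that every solution pair satisfies, on its whole domain, $$|z(t,j)|_{\mathcal A}\le\beta\big(|z(0,0)|_{\mathcal A},\mathcal T_k(t),j\big)+\gamma\big(|u|_{(t,j)}\big);$$ it is PT-S$_{\rm F}$ if there is $\beta\in\mathcal{KLL}$ such that this holds,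 without the last term, for every solution pair with $u\equiv0$; it is PT-ISS-C$_{\rm F}$ if there are $\beta\in\mathcal{KLL}$, $\gamma\in\mathcal K$ and $\beta_c\in\mathcal{KL}$ such that every solution pair satisfies, on its whole domain, $$|z(t,j)|_{\mathcal A}\le\beta_c\Big(\beta\big(|z(0,0)|_{\mathcal A},\mathcal T_k(t),j\big)+\gamma\big(|u|_{(t,j)}\big),\mathcal T_k(t)\Big).$$ \textbf{Lyapunov assumption with gain $\Delta:\mathbb R_{\ge1}\to\mathbb R_{\ge0}$.} There are smooth $V_q:\mathbb R^n\times\mathbb R_{\ge0}\to\mathbb R_{\ge0}$ and constants $c_{q,1},\dots,c_{q,5}>0$ ($q\in\mathcal Q$), $p>0$, $\chi\in(0,1]$ such that for all $x\in\mathbb R^n$, $u\in\mathbb R^m$, $\mu\ge1$, $\eta\in[0,\tau_d^{-1}]$: $c_{q,1}|x|^p\le V_q(x,\tau)\le c_{q,2}|x|^p$ for $\tau\in[0,N_0]$, $q\in\mathcal Q$; $$\langle\nabla V_q(x,\tau),(f_q(x,u,\tau,\mu),\eta)\rangle\le -c_{q,3}V_q(x,\tau)+c_{q,4}\Delta(\mu)|u|^p\quad\text{for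 }\tau\in[0,N_0],\ q\in\mathcal Q_s;$$ $$\langle\nabla V_q(x,\tau),(f_q(x,u,\tau,\mu),\eta)\rangle\le c_{q,5}V_q(x,\tau)+c_{q,4}\Delta(\mu)|u|^p\quad\text{for }\tau\in[0,N_0],\ q\in\mathcal Q_u;$$ and $V_q(R_o(x),\tau-1)\le\chi V_o(x,\tau)$ for $\tau\in[1,N_0]$ and $o\ne q$ in $\mathcal Q$. \textbf{Theorem.} Suppose the Lyapunov assumption holds with gain $\Delta$ and, with $r=\max_qc_{q,2}/\min_qc_{q,1}$, $\underline c_3=\min_qc_{q,3}$, $\overline c_5=\max_qc_{q,5}$ (over $q\in\mathcal Q$), $$1>\frac{\ln r}{\underline c_3\tau_d}+\frac1{\tau_a}\Big(1+\frac{\overline c_5}{\underline c_3}\Big).$$ (a) If $\Delta\equiv0$, then $\mathcal A$ is PT-S$_{\rm F}$. (b) If $\Delta\equiv1$, then $\mathcal A$ is PT-ISS$_{\rm F}$. (c) If $\Delta(\mu)=\mu^{-\ell}$ with $\ell>0$, then $\mathcal A$ is PT-ISS-C$_{\rm F}$. -/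

import Mathlib

open Set Filter Topology MeasureTheory
open scoped ContDiff

noncomputable section

/-! ## Comparison functions -/

/-- Class `𝒦` functions `[0,∞) → [0,∞)`; only the values on `[0,∞)` matter. -/
structure IsClassK (γ : ℝ → ℝ) : Prop where
  continuousOn : ContinuousOn γ (Ici 0)
  strictMonoOn : StrictMonoOn γ (Ici 0)
  map_zero : γ 0 = 0

/-- Class `𝒦ℒ` functions `[0,∞)² → [0,∞)`; only the values at nonnegative arguments matter. -/
structure IsClassKL (β : ℝ → ℝ → ℝ) : Prop where
  nonneg : ∀ r s, 0 ≤ r → 0 ≤ s → 0 ≤ β r s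
  monotoneOn : ∀ s, 0 ≤ s → MonotoneOn (fun r => β r s) (Ici 0)
  antitoneOn : ∀ r, 0 ≤ r → AntitoneOn (fun s => β r s) (Ici 0)
  tendsto_zero : ∀ s, 0 ≤ s → Tendsto (fun r => β r s) (𝓝[>] 0) (𝓝 0)
  tendsto_atTop : ∀ r, 0 ≤ r → Tendsto (fun s => β r s) atTop (𝓝 0)

/-- Class `𝒦ℒℒ`: class `𝒦ℒ` in (first, third) and in (first, second) argument. -/
def IsClassKLL (β : ℝ → ℝ → ℝ → ℝ) : Prop :=
  ∀ s, 0 ≤ s → IsClassKL (fun r t => β r s t) ∧ IsClassKL (fun r t => β r t s)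

/-! ## Hybrid dynamical systems with inputs -/

/-- The data `(C × U, F, D × U, G)` of a hybrid dynamical system with inputs. -/
structure HybridSystem (Z U : Type*) where
  /-- the states from which flows are allowed -/
  C : Set Z
  /-- the set-valued flow map -/
  F : Z → U → Set Z
  /-- the states from which jumps are allowed -/
  D : Set Z
  /-- the set-valued jump map -/
  G : Z → Set Z

/-- Compact hybrid time domains: `⋃_{j<J} [t_j, t_{j+1}] × {j}` with `0 = t_0 ≤ t_1 ≤ … ≤ t_J`. -/
def IsCompactHTD (E : Set (ℝ × ℕ)) : Prop :=
  ∃ (J : ℕ) (t : ℕ → ℝ), t 0 = 0 ∧ (∀ j < J, t j ≤ t (j + 1)) ∧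
    E = ⋃ j ∈ Finset.range J, Icc (t j) (t (j + 1)) ×ˢ {j}

/-- Hybrid time domains. -/
def IsHTD (E : Set (ℝ × ℕ)) : Prop :=
  (∀ p ∈ E, 0 ≤ p.1) ∧ ∀ p ∈ E, IsCompactHTD (E ∩ Icc 0 p.1 ×ˢ Iic p.2)

/-- The interval `I_j = {t : (t, j) ∈ E}`. -/
def flowInterval (E : Set (ℝ × ℕ)) (j : ℕ) : Set ℝ := {t | (t, j) ∈ E}

/-- Hybrid inputs with domain `E`: for each `j`, Lebesgue measurable and locally essentially
bounded on `I_j`. -/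
def IsHybridInput {U : Type*} [NormedAddCommGroup U] (E : Set (ℝ × ℕ)) (u : ℝ → ℕ → U) : Prop :=
  ∀ j, AEStronglyMeasurable (fun t => u t j) (volume.restrict (flowInterval E j)) ∧
    ∀ K ⊆ flowInterval E j, IsCompact K → ∃ M : ℝ, ∀ᵐ t ∂volume.restrict K, ‖u t j‖ ≤ M

/-- Hybrid arcs with domain `E`: for each `j` such that the interval `I_j` has nonempty interior,
`t ↦ z (t, j)` is locally absolutely continuous on `I_j`, i.e. absolutely continuous on every
compact subinterval of `I_j`. -/
def IsHybridArc {Z : Type*} [PseudoMetricSpace Z] (E : Set (ℝ × ℕ)) (z : ℝ → ℕ → Z) : Prop :=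
  ∀ j, (interior (flowInterval E j)).Nonempty →
    ∀ a ∈ flowInterval E j, ∀ b ∈ flowInterval E j,
      AbsolutelyContinuousOnInterval (fun t => z t j) a b

/-- `(z, u)`, with common domain `E`, is a solution pair of the hybrid system `H`. -/
structure IsSolutionPair {Z U : Type*} [NormedAddCommGroup Z] [NormedSpace ℝ Z]
    [NormedAddCommGroup U] (H : HybridSystem Z U) (E : Set (ℝ × ℕ))
    (z : ℝ → ℕ → Z) (u : ℝ → ℕ → U) : Prop where
  isHTD : IsHTD E
  zero_mem : ((0 : ℝ), 0) ∈ E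
  isHybridArc : IsHybridArc E z
  isHybridInput : IsHybridInput E u
  init : z 0 0 ∈ H.C ∪ H.D
  flow : ∀ j, (interior (flowInterval E j)).Nonempty →
    ∀ᵐ t ∂volume.restrict (flowInterval E j),
      z t j ∈ H.C ∧ ∃ v ∈ H.F (z t j) (u t j), HasDerivAt (fun s => z s j) v t
  jump : ∀ t j, (t, j) ∈ E → (t, j + 1) ∈ E → z t j ∈ H.D ∧ z t (j + 1) ∈ H.G (z t j)

/-- The values `|u(t', j')|` with `(t', j') ∈ E` and `(t', j') ≤ (t, j)`. -/
def inputSizes {U : Type*} [Norm U] (E : Set (ℝ × ℕ)) (u : ℝ → ℕ → U) (t : ℝ) (j : ℕ) : Set ℝ :=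
  {a | ∃ t' j', (t', j') ∈ E ∧ t' ≤ t ∧ j' ≤ j ∧ a = ‖u t' j'‖}

/-- `|u|_{(t,j)}`, the supremum of `|u|` up to hybrid time `(t, j)`. -/
def supInput {U : Type*} [Norm U] (E : Set (ℝ × ℕ)) (u : ℝ → ℕ → U) (t : ℝ) (j : ℕ) : ℝ :=
  sSup (inputSizes E u t j)

/-! ## The blow-up gain and the time dilation -/

/-- The prescribed time `Υ_{T,k} = T μ₀^{-1/k}`. -/
def prescribedTime (T k μ₀ : ℝ) : ℝ := T * μ₀ ^ (-(1 / k))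

/-- The blow-up gain `μ_k(t) = T^k / (Υ_{T,k} - t)^k` with `μ_k(0) = μ₀`. -/
def blowUpGain (T k μ₀ t : ℝ) : ℝ := T ^ k / (prescribedTime T k μ₀ - t) ^ k

/-- The function `ω_k(b, a)`. For `k = 1` it is the limit `T (log b - log a)` as `k → 1⁺`. -/
def omegaFun (T k b a : ℝ) : ℝ :=
  if k = 1 then T * (Real.log b - Real.log a)
  else T / k * ((b ^ ((k - 1) / k) - 1) / ((k - 1) / k) - (a ^ ((k - 1) / k) - 1) / ((k - 1) / k))

/-- The value of `omegaFun` at `k = 1` is the limit of its values as `k → 1⁺`. -/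
theorem tendsto_omegaFun_one (T : ℝ) {b a : ℝ} (hb : 0 < b) (ha : 0 < a) :
    Tendsto (fun k => omegaFun T k b a) (𝓝[>] 1) (𝓝 (omegaFun T 1 b a)) := by
  have key : ∀ c : ℝ, 0 < c →
      Tendsto (fun s : ℝ => (c ^ s - 1) / s) (𝓝[≠] 0) (𝓝 (Real.log c)) := by
    intro c hc
    have h := (Real.hasStrictDerivAt_const_rpow hc 0).hasDerivAt.tendsto_slope_zero
    simpa [div_eq_inv_mul] using h
  have hcont : ContinuousAt (fun k : ℝ => (k - 1) / k) 1 := by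
    fun_prop (disch := norm_num)
  have hs : Tendsto (fun k : ℝ => (k - 1) / k) (𝓝[>] 1) (𝓝[≠] 0) := by
    refine tendsto_nhdsWithin_iff.2 ⟨?_, ?_⟩
    · have := hcont.tendsto.mono_left (nhdsWithin_le_nhds (s := Ioi (1 : ℝ)))
      simpa using this
    · filter_upwards [self_mem_nhdsWithin] with k hk
      have hk' : (1 : ℝ) < k := hk
      exact (div_pos (by linarith) (by linarith)).ne'
  have hT : Tendsto (fun k : ℝ => T / k) (𝓝[>] 1) (𝓝 T) := by
    have hc : ContinuousAt (fun k : ℝ => T / k) 1 := by fun_prop (disch := norm_num)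
    simpa using hc.tendsto.mono_left (nhdsWithin_le_nhds (s := Ioi (1 : ℝ)))
  have := hT.mul (((key b hb).comp hs).sub ((key a ha).comp hs))
  have h1 : omegaFun T 1 b a = T * (Real.log b - Real.log a) := by simp [omegaFun]
  rw [h1]
  refine this.congr' ?_
  filter_upwards [self_mem_nhdsWithin] with k hk
  have hk' : (1 : ℝ) < k := hk
  simp [omegaFun, hk'.ne']

/-- The time dilation `𝒯_k(t) = ω_k(μ_k(t), μ_k(0))`, used for `0 ≤ t < Υ_{T,k}`. -/
def timeDilation (T k μ₀ t : ℝ) : ℝ := omegaFun T k (blowUpGain T k μ₀ t) μ₀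

/-! ## Prescribed-time hybrid systems and stability via flows -/

/-- The data `(F_Ψ, G_Ψ, Ψ_C, Ψ_D)`. -/
structure PTData (Ψ U : Type*) where
  /-- the map `F_Ψ(ψ, u, μ)` -/
  F : Ψ → U → ℝ → Set Ψ
  /-- the map `G_Ψ(ψ)` -/
  G : Ψ → Set Ψ
  /-- the set `Ψ_C` -/
  C : Set Ψ
  /-- the set `Ψ_D` -/
  D : Set Ψ

variable {Ψ U : Type*} [NormedAddCommGroup Ψ] [NormedSpace ℝ Ψ] [NormedAddCommGroup U]

/-- The hybrid system with state `z = (ψ, μ)` (Euclidean concatenation) generated by the data: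
flows `ψ' ∈ μ F_Ψ(ψ, u, μ)`, `μ' = (k/T) μ^{1+1/k}` on `Ψ_C × [1,∞)`, and jumps
`ψ⁺ ∈ G_Ψ(ψ)`, `μ⁺ = μ` on `Ψ_D × [1,∞)`. -/
def PTData.system (P : PTData Ψ U) (T k : ℝ) : HybridSystem (WithLp 2 (Ψ × ℝ)) U where
  C := {z | z.fst ∈ P.C ∧ 1 ≤ z.snd}
  F z u := {v | (∃ w ∈ P.F z.fst u z.snd, v.fst = z.snd • w) ∧
    v.snd = k / T * z.snd ^ (1 + 1 / k)}
  D := {z | z.fst ∈ P.D ∧ 1 ≤ z.snd}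
  G z := {z' | z'.fst ∈ P.G z.fst ∧ z'.snd = z.snd}

/-- The set `𝒜 = 𝒜₁ × [1,∞)`. -/
def targetSet (A₁ : Set Ψ) : Set (WithLp 2 (Ψ × ℝ)) := {z | z.fst ∈ A₁ ∧ 1 ≤ z.snd}

/-- `𝒜₁ × [1,∞)` is PT-ISS via flows. When `|u|_{(t,j)} = ∞` there is nothing to require, so the
bound is asked for whenever `u` is bounded up to hybrid time `(t, j)`. -/
def IsPTISSF (P : PTData Ψ U) (T k : ℝ) (A₁ : Set Ψ) : Prop :=
  ∃ (β : ℝ → ℝ → ℝ → ℝ) (γ : ℝ → ℝ), IsClassKLL β ∧ IsClassK γ ∧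
    ∀ E z u, IsSolutionPair (P.system T k) E z u → ∀ t j, (t, j) ∈ E →
      BddAbove (inputSizes E u t j) →
      Metric.infDist (z t j) (targetSet A₁) ≤
        β (Metric.infDist (z 0 0) (targetSet A₁)) (timeDilation T k (z 0 0).snd t) j
          + γ (supInput E u t j)

/-- `𝒜₁ × [1,∞)` is PT-stable via flows: the PT-ISS bound for solutions with `u ≡ 0`. -/
def IsPTSF (P : PTData Ψ U) (T k : ℝ) (A₁ : Set Ψ) : Prop :=
  ∃ β : ℝ → ℝ → ℝ → ℝ, IsClassKLL β ∧
    ∀ E z u, IsSolutionPair (P.system T k) E z u → (∀ t j, (t, j) ∈ E → u t j = 0) →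
      ∀ t j, (t, j) ∈ E →
      Metric.infDist (z t j) (targetSet A₁) ≤
        β (Metric.infDist (z 0 0) (targetSet A₁)) (timeDilation T k (z 0 0).snd t) j

/-- `𝒜₁ × [1,∞)` is PT-ISS and convergent via flows. -/
def IsPTISSCF (P : PTData Ψ U) (T k : ℝ) (A₁ : Set Ψ) : Prop :=
  ∃ (β : ℝ → ℝ → ℝ → ℝ) (γ : ℝ → ℝ) (βc : ℝ → ℝ → ℝ),
    IsClassKLL β ∧ IsClassK γ ∧ IsClassKL βc ∧
    ∀ E z u, IsSolutionPair (P.system T k) E z u → ∀ t j, (t, j) ∈ E →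
      BddAbove (inputSizes E u t j) →
      Metric.infDist (z t j) (targetSet A₁) ≤
        βc (β (Metric.infDist (z 0 0) (targetSet A₁)) (timeDilation T k (z 0 0).snd t) j
            + γ (supInput E u t j))
          (timeDilation T k (z 0 0).snd t)

/-! ## Switching systems with stable and unstable modes -/

/-- The space of `ψ = (x, (τ, ρ, q)) ∈ ℝⁿ⁺³` with its Euclidean norm. -/
abbrev SwitchState (n : ℕ) : Type :=
  WithLp 2 (EuclideanSpace ℝ (Fin n) × EuclideanSpace ℝ (Fin 3))

namespace SwitchState

variable {n : ℕ}

/-- the continuous state `x` -/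
def x (ψ : SwitchState n) : EuclideanSpace ℝ (Fin n) := ψ.fst
/-- the dwell-time timer `τ` -/
def τ (ψ : SwitchState n) : ℝ := ψ.snd 0
/-- the activation-time monitor `ρ` -/
def ρ (ψ : SwitchState n) : ℝ := ψ.snd 1
/-- the logic state `q` -/
def q (ψ : SwitchState n) : ℝ := ψ.snd 2

end SwitchState

/-- The modes are `1, …, N`; `modeLabel` sends the index `i = 0, …, N - 1` to `i + 1`. -/
def modeLabel {N : ℕ} (i : Fin N) : ℝ := (i : ℝ) + 1

/-- The data of the switching system with vector fields `f_q(x, u, τ, μ)`, resets `R_q`, set of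
unstable modes `Qu`, dwell-time timer `τ` and activation-time monitor `ρ`. -/
def switchedData {N n m : ℕ}
    (f : Fin N → EuclideanSpace ℝ (Fin n) → EuclideanSpace ℝ (Fin m) → ℝ → ℝ →
      EuclideanSpace ℝ (Fin n))
    (R : Fin N → EuclideanSpace ℝ (Fin n) → EuclideanSpace ℝ (Fin n))
    (Qu : Set (Fin N)) (τd τa N₀ T₀ : ℝ) :
    PTData (SwitchState n) (EuclideanSpace ℝ (Fin m)) where
  F ψ u μ := {v | ∃ i : Fin N, ψ.q = modeLabel i ∧
    v.x = f i ψ.x u ψ.τ μ ∧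
    v.τ ∈ Icc 0 (1 / τd) ∧
    (∃ w ∈ Icc 0 (1 / τa), v.ρ = w - Qu.indicator (fun _ => (1 : ℝ)) i) ∧
    v.q = 0}
  G ψ := {ψ' | ∃ i i' : Fin N, ψ.q = modeLabel i ∧ ψ'.q = modeLabel i' ∧ i' ≠ i ∧
    ψ'.x = R i ψ.x ∧ ψ'.τ = ψ.τ - 1 ∧ ψ'.ρ = ψ.ρ}
  C := {ψ | ψ.τ ∈ Icc 0 N₀ ∧ ψ.ρ ∈ Icc 0 T₀ ∧ ψ.q ∈ range (modeLabel (N := N))}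
  D := {ψ | ψ.τ ∈ Icc 1 N₀ ∧ ψ.ρ ∈ Icc 0 T₀ ∧ ψ.q ∈ range (modeLabel (N := N))}

/-- The set `𝒜₁ = {0} × [0, N₀] × [0, T₀] × {1, …, N}`. -/
def switchedTarget (N n : ℕ) (N₀ T₀ : ℝ) : Set (SwitchState n) :=
  {ψ | ψ.x = 0 ∧ ψ.τ ∈ Icc 0 N₀ ∧ ψ.ρ ∈ Icc 0 T₀ ∧ ψ.q ∈ range (modeLabel (N := N))}

/-- Regularity of the vector fields (locally Lipschitz on `ℝⁿ × ℝᵐ × [0,∞) × [1,∞)`) and of the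
reset maps. -/
structure RegularityAssumption {N n m : ℕ}
    (f : Fin N → EuclideanSpace ℝ (Fin n) → EuclideanSpace ℝ (Fin m) → ℝ → ℝ →
      EuclideanSpace ℝ (Fin n))
    (R : Fin N → EuclideanSpace ℝ (Fin n) → EuclideanSpace ℝ (Fin n)) : Prop where
  locallyLipschitz : ∀ q, LocallyLipschitzOn
    {w : EuclideanSpace ℝ (Fin n) × EuclideanSpace ℝ (Fin m) × ℝ × ℝ |
      0 ≤ w.2.2.1 ∧ 1 ≤ w.2.2.2}
    (fun w => f q w.1 w.2.1 w.2.2.1 w.2.2.2)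
  continuous_reset : ∀ q, Continuous (R q)

/-- The derivative `⟨∇V(x, τ), (v, η)⟩` of `V : ℝⁿ × [0,∞) → ℝ`; at `τ = 0` the derivative in `τ`
is one-sided. -/
def lieDerivative {n : ℕ} (V : EuclideanSpace ℝ (Fin n) → ℝ → ℝ)
    (x : EuclideanSpace ℝ (Fin n)) (τ : ℝ) (v : EuclideanSpace ℝ (Fin n)) (η : ℝ) : ℝ :=
  fderivWithin ℝ (fun w : EuclideanSpace ℝ (Fin n) × ℝ => V w.1 w.2) (univ ×ˢ Ici 0) (x, τ) (v, η)

/-- The Lyapunov conditions on the modes, with gain `Δ(μ)` on the input. -/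
structure LyapunovAssumption {N n m : ℕ}
    (f : Fin N → EuclideanSpace ℝ (Fin n) → EuclideanSpace ℝ (Fin m) → ℝ → ℝ →
      EuclideanSpace ℝ (Fin n))
    (R : Fin N → EuclideanSpace ℝ (Fin n) → EuclideanSpace ℝ (Fin n))
    (Qu : Set (Fin N)) (τd N₀ : ℝ) (Δ : ℝ → ℝ)
    (V : Fin N → EuclideanSpace ℝ (Fin n) → ℝ → ℝ)
    (c₁ c₂ c₃ c₄ c₅ : Fin N → ℝ) (p χ : ℝ) : Prop where
  p_pos : 0 < p
  c_pos : ∀ q, 0 < c₁ q ∧ 0 < c₂ q ∧ 0 < c₃ q ∧ 0 < c₄ q ∧ 0 < c₅ q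
  smooth : ∀ q, ContDiffOn ℝ ∞ (fun w : EuclideanSpace ℝ (Fin n) × ℝ => V q w.1 w.2)
    (univ ×ˢ Ici 0)
  nonneg : ∀ q x τ, 0 ≤ τ → 0 ≤ V q x τ
  bounds : ∀ q x, ∀ τ ∈ Icc 0 N₀, c₁ q * ‖x‖ ^ p ≤ V q x τ ∧ V q x τ ≤ c₂ q * ‖x‖ ^ p
  stable : ∀ q ∉ Qu, ∀ x u, ∀ τ ∈ Icc 0 N₀, ∀ μ, 1 ≤ μ → ∀ η ∈ Icc 0 τd⁻¹,
    lieDerivative (V q) x τ (f q x u τ μ) η ≤ -c₃ q * V q x τ + c₄ q * Δ μ * ‖u‖ ^ p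
  unstable : ∀ q ∈ Qu, ∀ x u, ∀ τ ∈ Icc 0 N₀, ∀ μ, 1 ≤ μ → ∀ η ∈ Icc 0 τd⁻¹,
    lieDerivative (V q) x τ (f q x u τ μ) η ≤ c₅ q * V q x τ + c₄ q * Δ μ * ‖u‖ ^ p
  χ_mem : χ ∈ Ioc 0 1
  reset : ∀ o q, q ≠ o → ∀ x, ∀ τ ∈ Icc 1 N₀, V q (R o x) (τ - 1) ≤ χ * V o x τ

/-- The ratio `r = max_q c_{q,2} / min_q c_{q,1}`. -/
def lyapunovRatio {N : ℕ} (c₁ c₂ : Fin N → ℝ) : ℝ := (⨆ q, c₂ q) / (⨅ q, c₁ q)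

end

/-! ## Absolutely continuous functions -/

/-! In the dilated time σ with dσ = μ dt the factor μ disappears from the flow. Since μ' = (k/T)
μ^(1+1/k), the quantity μ^(-1/k) is affine in t, so μ is `blowUpGain` and σ is `timeDilation`.

In this time scale the single function W = V_q exp(Aτ + Bρ) serves all modes. Let C₃ be the least
c_{q,3} and C₅ the greatest c_{q,5}. For B = C₃ + C₅ the term -B that ρ contributes in an unstable
mode turns the growth rate C₅ into -C₃, so in every mode dW/dσ ≤ (-C₃ + A/τd + B/τa) W + input
(`LyapunovAssumption.deriv_le`). A jump lowers τ by one and does not increase V, so it multiplies W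
by at most exp(-A). As ln r ≥ 0, the dwell-time condition gives B/τa < C₃; with 2c the gap between
the two sides, A = c τd leaves the rate -c along flows.

The input contributes at most D μ^(-ℓ) to dW/dσ. For ν ≤ ℓ small enough, a multiple of μ^(-ν) decays
slowly enough to absorb it (`comparison_blowUp`). Because μ ≥ 1 + (k/T)σ (`one_add_omegaFun_le`),
both the transient and the input term carry a common factor (1 + (k/T)σ)^(-ν). After p-th roots this
is `LyapunovAssumption.exists_norm_x_le`. For ℓ = 0 the factor is dropped, which gives (a) and (b);
for ℓ > 0 it is the convergence function in (c).

Finally, solutions remain in the closed flow set (`IsSolutionPair.mem_flowSet`), where the distance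
to the target is ‖x‖ (`infDist_targetSet_eq`). -/

theorem LipschitzOnWith.comp_absolutelyContinuousOnInterval {X Y : Type*} [PseudoMetricSpace X]
    [PseudoMetricSpace Y] {K : NNReal} {H : X → Y} {S : Set X} (hH : LipschitzOnWith K H S)
    {g : ℝ → X} {a b : ℝ} (hg : AbsolutelyContinuousOnInterval g a b)
    (hS : ∀ t ∈ uIcc a b, g t ∈ S) :
    AbsolutelyContinuousOnInterval (fun t => H (g t)) a b := by
  rw [absolutelyContinuousOnInterval_iff] at hg ⊢
  intro ε hε
  obtain ⟨δ, hδ, h⟩ := hg (ε / (K + 1)) (by positivity)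
  refine ⟨δ, hδ, fun I hI hlt => ?_⟩
  have h1 := h I hI hlt
  have h2 : ∑ i ∈ Finset.range I.1, dist (H (g (I.2 i).1)) (H (g (I.2 i).2)) ≤
      K * ∑ i ∈ Finset.range I.1, dist (g (I.2 i).1) (g (I.2 i).2) := by
    rw [Finset.mul_sum]
    exact Finset.sum_le_sum fun i hi =>
      hH.dist_le_mul _ (hS _ (hI.1 i hi).1) _ (hS _ (hI.1 i hi).2)
  have h3 : 0 ≤ ∑ i ∈ Finset.range I.1, dist (g (I.2 i).1) (g (I.2 i).2) :=
    Finset.sum_nonneg fun _ _ => dist_nonneg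
  rw [lt_div_iff₀ (by positivity)] at h1
  nlinarith [K.coe_nonneg]

theorem ContinuousLinearMap.comp_absolutelyContinuousOnInterval {X Y : Type*}
    [NormedAddCommGroup X] [NormedSpace ℝ X] [NormedAddCommGroup Y] [NormedSpace ℝ Y]
    (L : X →L[ℝ] Y) {g : ℝ → X} {a b : ℝ} (hg : AbsolutelyContinuousOnInterval g a b) :
    AbsolutelyContinuousOnInterval (fun t => L (g t)) a b :=
  (L.lipschitz.lipschitzOnWith (s := univ)).comp_absolutelyContinuousOnInterval hg
    fun _ _ => mem_univ _

/-- An absolutely continuous path is bounded, so it stays in a compact convex piece of `S`, and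
there a C¹ map is Lipschitz. -/
theorem ContDiffOn.comp_absolutelyContinuousOnInterval {X Y : Type*}
    [NormedAddCommGroup X] [NormedSpace ℝ X] [FiniteDimensional ℝ X]
    [NormedAddCommGroup Y] [NormedSpace ℝ Y] {H : X → Y} {S : Set X}
    (hH : ContDiffOn ℝ 1 H S) (hconv : Convex ℝ S) (hclosed : IsClosed S)
    {g : ℝ → X} {a b : ℝ} (hg : AbsolutelyContinuousOnInterval g a b)
    (hS : ∀ t ∈ uIcc a b, g t ∈ S) :
    AbsolutelyContinuousOnInterval (fun t => H (g t)) a b := by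
  have : ProperSpace X := FiniteDimensional.proper ℝ X
  obtain ⟨r, hr⟩ := hg.exists_bound
  obtain ⟨K, hK⟩ := (hH.mono inter_subset_left).exists_lipschitzOnWith one_ne_zero
    (hconv.inter (convex_closedBall (0 : X) r))
    ((isCompact_closedBall (0 : X) r).inter_left hclosed)
  exact hK.comp_absolutelyContinuousOnInterval hg
    fun t ht => ⟨hS t ht, by simpa using hr t ht⟩

theorem AbsolutelyContinuousOnInterval.prodMk {X Y : Type*}
    [NormedAddCommGroup X] [NormedSpace ℝ X] [NormedAddCommGroup Y] [NormedSpace ℝ Y]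
    {f : ℝ → X} {g : ℝ → Y} {a b : ℝ}
    (hf : AbsolutelyContinuousOnInterval f a b) (hg : AbsolutelyContinuousOnInterval g a b) :
    AbsolutelyContinuousOnInterval (fun t => (f t, g t)) a b := by
  simpa using ((ContinuousLinearMap.inl ℝ X Y).comp_absolutelyContinuousOnInterval hf).fun_add
    ((ContinuousLinearMap.inr ℝ X Y).comp_absolutelyContinuousOnInterval hg)

theorem ContDiffOn.comp_prodMk_absolutelyContinuousOnInterval {X : Type*}
    [NormedAddCommGroup X] [NormedSpace ℝ X] [FiniteDimensional ℝ X] {V : X → ℝ → ℝ}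
    (hV : ContDiffOn ℝ 1 (fun w : X × ℝ => V w.1 w.2) (univ ×ˢ Ici 0)) {x : ℝ → X} {τ : ℝ → ℝ}
    {a b : ℝ} (hx : AbsolutelyContinuousOnInterval x a b)
    (hτ : AbsolutelyContinuousOnInterval τ a b) (hτ0 : ∀ t ∈ uIcc a b, 0 ≤ τ t) :
    AbsolutelyContinuousOnInterval (fun t => V (x t) (τ t)) a b :=
  ContDiffOn.comp_absolutelyContinuousOnInterval (H := fun w : X × ℝ => V w.1 w.2)
    (g := fun t => (x t, τ t)) hV (convex_univ.prod (convex_Ici 0))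
    (isClosed_univ.prod isClosed_Ici) (hx.prodMk hτ) fun t ht => ⟨mem_univ _, hτ0 t ht⟩

/-- The mean value inequality for absolutely continuous functions. -/
theorem AbsolutelyContinuousOnInterval.sub_le_of_ae_hasDerivAt_le {f : ℝ → ℝ} {a b c : ℝ}
    (hf : AbsolutelyContinuousOnInterval f a b) (hab : a ≤ b)
    (h : ∀ᵐ t ∂volume.restrict (Icc a b), ∃ d ≤ c, HasDerivAt f d t) :
    f b - f a ≤ c * (b - a) := by
  rw [← hf.integral_deriv_eq_sub]
  have h1 : ∫ t in a..b, deriv f t ≤ ∫ _ in a..b, c := by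
    refine intervalIntegral.integral_mono_ae_restrict hab hf.intervalIntegrable_deriv
      intervalIntegrable_const ?_
    filter_upwards [h] with t ⟨d, hd, hd'⟩
    rwa [hd'.deriv]
  simpa [mul_comm] using h1

/-! ## Hybrid time domains -/

/-- The domain cut at `(t, j)` is compact, and the right end of its `j`-th interval belongs to the
cut, so it is at most `t`. The last clause makes each flow interval free of gaps. -/
theorem IsHTD.exists_times {E : Set (ℝ × ℕ)} (hE : IsHTD E) {t : ℝ} {j : ℕ} (h : (t, j) ∈ E) :
    ∃ τ : ℕ → ℝ, τ 0 = 0 ∧ τ (j + 1) = t ∧ (∀ i ≤ j, τ i ≤ τ (i + 1)) ∧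
      (∀ i ≤ j, Icc (τ i) (τ (i + 1)) ⊆ flowInterval E i) ∧
      ∀ s, (s, j) ∈ E → s ≤ t → τ j ≤ s := by
  obtain ⟨J, τ, h0, hmono, hEq⟩ := hE.2 _ h
  have hmem : ∀ s i, (s, i) ∈ E ∩ Icc 0 t ×ˢ Iic j ↔ i < J ∧ τ i ≤ s ∧ s ≤ τ (i + 1) := by
    intro s i
    rw [show E ∩ Icc 0 t ×ˢ Iic j = _ from hEq]
    simp only [mem_iUnion, Finset.mem_range, mem_prod, mem_Icc, mem_singleton_iff, exists_prop]
    constructor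
    · rintro ⟨i', hi', hs, rfl⟩; exact ⟨hi', hs⟩
    · rintro ⟨hi, hs⟩; exact ⟨i, hi, hs, rfl⟩
  have hj := (hmem t j).1 ⟨h, ⟨hE.1 _ h, le_refl t⟩, mem_Iic.2 le_rfl⟩
  have hend := (hmem (τ (j + 1)) j).2 ⟨hj.1, hmono j hj.1, le_rfl⟩
  refine ⟨τ, h0, le_antisymm hend.2.1.2 hj.2.2, fun i hi => hmono i (hi.trans_lt hj.1),
    fun i hi s hs => ((hmem s i).2 ⟨hi.trans_lt hj.1, hs⟩).1, fun s hs hst => ?_⟩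
  exact ((hmem s j).1 ⟨hs, ⟨hE.1 _ hs, hst⟩, mem_Iic.2 le_rfl⟩).2.1

theorem IsHTD.Icc_subset_flowInterval {E : Set (ℝ × ℕ)} (hE : IsHTD E) {s t : ℝ} {j : ℕ}
    (hs : (s, j) ∈ E) (ht : (t, j) ∈ E) : Icc s t ⊆ flowInterval E j := by
  intro r hr
  obtain ⟨τ, -, hτ, -, hsub, hle⟩ := hE.exists_times ht
  exact hsub j le_rfl ⟨(hle s hs (hr.1.trans hr.2)).trans hr.1, hτ ▸ hr.2⟩

/-- Induction along a hybrid time domain: through flows and through jumps. -/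
theorem IsHTD.induction {E : Set (ℝ × ℕ)} (hE : IsHTD E) (h00 : ((0 : ℝ), 0) ∈ E)
    {P : ℝ → ℕ → Prop} (base : P 0 0)
    (flow : ∀ j s t, s < t → (s, j) ∈ E → (t, j) ∈ E → Icc s t ⊆ flowInterval E j →
      P s j → P t j)
    (jump : ∀ t j, (t, j) ∈ E → (t, j + 1) ∈ E → P t j → P t (j + 1)) :
    ∀ j t, (t, j) ∈ E → P t j := by
  -- Arcs are regular only on intervals with interior, so the flow hypothesis is asked for `s < t`;
  -- a one-point interval needs nothing.
  have flow' : ∀ j s t, s ≤ t → (s, j) ∈ E → (t, j) ∈ E → P s j → P t j := by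
    intro j s t hst hs ht hP
    rcases hst.eq_or_lt with rfl | hlt
    · exact hP
    · exact flow j s t hlt hs ht (hE.Icc_subset_flowInterval hs ht) hP
  intro j
  induction j with
  | zero => exact fun t ht => flow' 0 0 t (hE.1 _ ht) h00 ht base
  | succ j ih =>
    intro t ht
    obtain ⟨τ, -, hτ, hmono, hsub, -⟩ := hE.exists_times ht
    have h1 : (τ (j + 1), j) ∈ E := hsub j (by omega) ⟨hmono j (by omega), le_rfl⟩
    have h2 : (τ (j + 1), j + 1) ∈ E := hsub (j + 1) le_rfl ⟨le_rfl, hmono (j + 1) le_rfl⟩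
    exact flow' (j + 1) _ t (hτ ▸ hmono (j + 1) le_rfl) h2 ht (jump _ _ h1 h2 (ih _ h1))

/-! ## The time dilation as a function of the blow-up gain -/

/-- Multiplied by μ' = (k/T) μ^(1+1/k), this derivative gives exactly μ: along solutions ω_k is the
dilated time. -/
theorem hasDerivAt_omegaFun {T k a b : ℝ} (hk : 1 ≤ k) (hb : 0 < b) :
    HasDerivAt (fun b => omegaFun T k b a) (T / k * b ^ (-(1 / k))) b := by
  unfold omegaFun
  split_ifs with h
  · subst h
    have := (((Real.hasDerivAt_log hb.ne').sub_const (Real.log a)).const_mul T)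
    simpa [Real.rpow_neg_one] using this
  · have hk0 : 0 < k := by linarith
    have hθ : (k - 1) / k ≠ 0 := div_ne_zero (sub_ne_zero.2 h) hk0.ne'
    have h1 := (((((Real.hasDerivAt_rpow_const (p := (k - 1) / k) (Or.inl hb.ne')).sub_const
      1).div_const ((k - 1) / k)).sub_const ((a ^ ((k - 1) / k) - 1) / ((k - 1) / k))).const_mul
      (T / k))
    convert! h1 using 1
    rw [mul_div_cancel_left₀ _ hθ]
    congr 2
    field_simp
    ring

theorem omegaFun_self (T k a : ℝ) : omegaFun T k a a = 0 := by
  unfold omegaFun; split_ifs <;> simp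

theorem omegaFun_nonneg {T k a b : ℝ} (hT : 0 < T) (hk : 1 ≤ k) (ha : 1 ≤ a) (hab : a ≤ b) :
    0 ≤ omegaFun T k b a := by
  have hpos : ∀ x ∈ Ici (1 : ℝ), 0 < x := fun x hx => zero_lt_one.trans_le hx
  have hmono : MonotoneOn (fun b => omegaFun T k b a) (Ici 1) := by
    refine monotoneOn_of_hasDerivWithinAt_nonneg (convex_Ici 1)
      (fun x hx => (hasDerivAt_omegaFun hk (hpos x hx)).continuousAt.continuousWithinAt)
      (fun x hx => (hasDerivAt_omegaFun hk (hpos x (interior_subset hx))).hasDerivWithinAt)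
      fun x hx => ?_
    have := hpos x (interior_subset hx)
    positivity
  simpa [omegaFun_self] using hmono ha (ha.trans hab) hab

/-- The map b ↦ b - (k/T) ω_k(b, a) has derivative 1 - b^(-1/k) ≥ 0 on [1, ∞) and equals a ≥ 1 at b
= a. This turns decay in μ into decay in dilated time. -/
theorem one_add_omegaFun_le {T k a b : ℝ} (hT : 0 < T) (hk : 1 ≤ k) (ha : 1 ≤ a)
    (hab : a ≤ b) : 1 + k / T * omegaFun T k b a ≤ b := by
  have hpos : ∀ x ∈ Ici (1 : ℝ), 0 < x := fun x hx => zero_lt_one.trans_le hx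
  have hk0 : 0 < k := by linarith
  have hd : ∀ x ∈ Ici (1 : ℝ), HasDerivAt (fun b => b - k / T * omegaFun T k b a)
      (1 - k / T * (T / k * x ^ (-(1 / k)))) x := fun x hx =>
    (hasDerivAt_id x).sub ((hasDerivAt_omegaFun hk (hpos x hx)).const_mul (k / T))
  have hmono : MonotoneOn (fun b => b - k / T * omegaFun T k b a) (Ici 1) := by
    refine monotoneOn_of_hasDerivWithinAt_nonneg (convex_Ici 1)
      (fun x hx => (hd x hx).continuousAt.continuousWithinAt)
      (fun x hx => (hd x (interior_subset hx)).hasDerivWithinAt)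
      fun x hx => ?_
    have h1 : k / T * (T / k * x ^ (-(1 / k))) = x ^ (-(1 / k)) := by field_simp
    rw [h1, sub_nonneg]
    exact Real.rpow_le_one_of_one_le_of_nonpos (interior_subset hx)
      (neg_nonpos.2 (by positivity))
  have := hmono ha (ha.trans hab) hab
  simp only [omegaFun_self] at this
  linarith

theorem contDiffOn_omegaFun {T k a : ℝ} : ContDiffOn ℝ 1 (fun b => omegaFun T k b a) (Ici 1) := by
  have hne : ∀ x ∈ Ici (1 : ℝ), x ≠ 0 := fun x hx => (zero_lt_one.trans_le hx).ne'
  unfold omegaFun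
  split_ifs with h
  · exact contDiffOn_const.mul ((contDiffOn_id.log hne).sub contDiffOn_const)
  · exact contDiffOn_const.mul
      ((((contDiffOn_id.rpow_const_of_ne hne).sub contDiffOn_const).div_const _).sub
        contDiffOn_const)

/-- Comparison of a solution of `w' ≤ μ (-c w + D μ^{-ℓ})` with a multiple of `μ^{-ν}`. -/
theorem comparison_blowUp {T k c D ℓ ν μ₀ a b : ℝ} {w μ : ℝ → ℝ}
    (hT : 0 < T) (hk : 1 ≤ k) (hc : 0 < c) (hD : 0 ≤ D)
    (hνℓ : ν ≤ ℓ) (hνc : ν * (k / T) ≤ c / 2) (hab : a ≤ b)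
    (hw : AbsolutelyContinuousOnInterval w a b) (hμ : AbsolutelyContinuousOnInterval μ a b)
    (hμ1 : ∀ t ∈ Icc a b, 1 ≤ μ t)
    (hμd : ∀ᵐ t ∂volume.restrict (Icc a b), HasDerivAt μ (k / T * μ t ^ (1 + 1 / k)) t)
    (hwd : ∀ᵐ t ∂volume.restrict (Icc a b),
      ∃ w' ≤ μ t * (-c * w t + D * μ t ^ (-ℓ)), HasDerivAt w w' t) :
    Real.exp (c * omegaFun T k (μ b) μ₀) * (w b - 2 * D / c * μ b ^ (-ν)) ≤
      Real.exp (c * omegaFun T k (μ a) μ₀) * (w a - 2 * D / c * μ a ^ (-ν)) := by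
  have hne : ∀ x ∈ Ici (1 : ℝ), x ≠ 0 := fun x hx => (zero_lt_one.trans_le hx).ne'
  have hS : ∀ t ∈ uIcc a b, μ t ∈ Ici (1 : ℝ) := by rwa [uIcc_of_le hab]
  have hk0 : 0 < k := by linarith
  have hexp : AbsolutelyContinuousOnInterval
      (fun t => Real.exp (c * omegaFun T k (μ t) μ₀)) a b :=
    ((contDiffOn_const.mul contDiffOn_omegaFun).exp (f := fun b => c * omegaFun T k b μ₀)
      ).comp_absolutelyContinuousOnInterval (convex_Ici 1) isClosed_Ici hμ hS
  have hpow : AbsolutelyContinuousOnInterval (fun t => μ t ^ (-ν)) a b :=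
    (contDiffOn_id.rpow_const_of_ne hne).comp_absolutelyContinuousOnInterval
      (convex_Ici 1) isClosed_Ici hμ hS
  -- It suffices that this product has nonpositive derivative almost everywhere.
  have hΦ := hexp.fun_mul (hw.fun_sub (hpow.const_mul (2 * D / c)))
  have := hΦ.sub_le_of_ae_hasDerivAt_le (c := 0) hab ?_
  · linarith
  filter_upwards [hμd, hwd, ae_restrict_mem measurableSet_Icc] with t hμt ⟨w', hw', hwt⟩ ht
  have hm : 1 ≤ μ t := hμ1 t ht
  have hm0 : 0 < μ t := by linarith
  have hω : HasDerivAt (fun t => Real.exp (c * omegaFun T k (μ t) μ₀))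
      (Real.exp (c * omegaFun T k (μ t) μ₀) * (c * μ t)) t := by
    have h1 := (((hasDerivAt_omegaFun (T := T) (a := μ₀) hk hm0).comp t hμt).const_mul c).exp
    convert! h1 using 3
    have h2 : μ t ^ (1 + 1 / k) = μ t * μ t ^ (1 / k) := by
      rw [Real.rpow_add hm0, Real.rpow_one]
    rw [h2, Real.rpow_neg hm0.le]
    have : μ t ^ (1 / k) ≠ 0 := (Real.rpow_pos_of_pos hm0 _).ne'
    field_simp
  have hp : HasDerivAt (fun t => μ t ^ (-ν)) (-(ν * (k / T)) * μ t ^ (-ν) * μ t ^ (1 / k)) t := by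
    have h1 := hμt.rpow_const (p := -ν) (Or.inl hm0.ne')
    convert! h1 using 1
    have h2 : μ t ^ (1 + 1 / k) = μ t * μ t ^ (1 / k) := by
      rw [Real.rpow_add hm0, Real.rpow_one]
    have h3 : μ t ^ (-ν) = μ t ^ (-ν - 1) * μ t := by
      rw [← Real.rpow_add_one hm0.ne']; ring_nf
    rw [h2, h3]
    ring
  refine ⟨_, ?_, hω.mul (hwt.sub (hp.const_mul (2 * D / c)))⟩
  set e := Real.exp (c * omegaFun T k (μ t) μ₀)
  set P := μ t ^ (-ν)
  have he : 0 < e := Real.exp_pos _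
  have hP : 0 < P := Real.rpow_pos_of_pos hm0 _
  have hQ : μ t ^ (-ℓ) ≤ P := Real.rpow_le_rpow_of_exponent_le hm (by linarith)
  -- Here k ≥ 1 enters: with ν k/T ≤ c/2, the power μ^(-ν) decays in dilated time at rate at most
  -- c/2.
  have hR : μ t ^ (1 / k) ≤ μ t := by
    conv_rhs => rw [← Real.rpow_one (μ t)]
    exact Real.rpow_le_rpow_of_exponent_le hm ((div_le_one hk0).2 hk)
  have hR0 : 0 < μ t ^ (1 / k) := Real.rpow_pos_of_pos hm0 _
  have h1 : ν * (k / T) * P * μ t ^ (1 / k) ≤ c / 2 * P * μ t :=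
    calc ν * (k / T) * P * μ t ^ (1 / k) ≤ c / 2 * P * μ t ^ (1 / k) := by gcongr
      _ ≤ c / 2 * P * μ t := by gcongr
  have h2 : 2 * D / c * (ν * (k / T) * P * μ t ^ (1 / k)) ≤ D * P * μ t :=
    calc _ ≤ 2 * D / c * (c / 2 * P * μ t) := by gcongr
      _ = D * P * μ t := by field_simp
  have h3 : μ t * (D * μ t ^ (-ℓ)) ≤ μ t * (D * P) := by gcongr
  have h4 : c * μ t * (2 * D / c * P) = 2 * D * P * μ t := by field_simp
  have : c * μ t * (w t - 2 * D / c * P) + (w' + 2 * D / c * (ν * (k / T) * P * μ t ^ (1 / k)))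
      ≤ 0 := by nlinarith
  nlinarith

/-! ## Coordinates of the hybrid state -/

namespace SwitchState

variable (n : ℕ)

/-- The coordinate `x` as a continuous linear map of `z = (ψ, μ)`. -/
noncomputable def xL : WithLp 2 (SwitchState n × ℝ) →L[ℝ] EuclideanSpace ℝ (Fin n) :=
  (WithLp.fstL 2 ℝ _ _).comp (WithLp.fstL 2 ℝ _ _)

/-- The `i`-th of the coordinates `τ, ρ, q` as a continuous linear map of `z = (ψ, μ)`. -/
noncomputable def auxL (i : Fin 3) : WithLp 2 (SwitchState n × ℝ) →L[ℝ] ℝ :=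
  (EuclideanSpace.proj i).comp ((WithLp.sndL 2 ℝ _ _).comp (WithLp.fstL 2 ℝ _ _))

/-- The coordinate `μ` as a continuous linear map of `z = (ψ, μ)`. -/
noncomputable def μL : WithLp 2 (SwitchState n × ℝ) →L[ℝ] ℝ := WithLp.sndL 2 ℝ _ _

end SwitchState

open SwitchState

theorem modeLabel_injective {N : ℕ} : Function.Injective (modeLabel (N := N)) := by
  intro i j h
  simpa [modeLabel, Fin.ext_iff] using h

/-! ### Distance to the target set -/

theorem norm_x_le_infDist {N n : ℕ} {N₀ T₀ : ℝ} {z : WithLp 2 (SwitchState n × ℝ)}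
    (hne : (targetSet (switchedTarget N n N₀ T₀)).Nonempty) :
    ‖z.fst.x‖ ≤ Metric.infDist z (targetSet (switchedTarget N n N₀ T₀)) := by
  refine (Metric.le_infDist hne).2 fun y hy => ?_
  have h1 : ‖z.fst.x‖ ≤ ‖(z - y).fst.fst‖ := by
    have : (z - y).fst.fst = z.fst.x - y.fst.x := rfl
    rw [this, hy.1.1, sub_zero]
  rw [dist_eq_norm]
  exact h1.trans ((WithLp.norm_fst_le _ _).trans (WithLp.norm_fst_le _ _))

/-- The projection of `z` onto the set `x = 0`. -/
noncomputable def zeroX {n : ℕ} (z : WithLp 2 (SwitchState n × ℝ)) :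
    WithLp 2 (SwitchState n × ℝ) :=
  WithLp.toLp 2 (WithLp.toLp 2 (0, z.fst.snd), z.snd)

theorem dist_zeroX {n : ℕ} (z : WithLp 2 (SwitchState n × ℝ)) : dist z (zeroX z) = ‖z.fst.x‖ := by
  simp [WithLp.prod_dist_eq_of_L2, zeroX, SwitchState.x]

section Switched

variable {N n m : ℕ}
  {f : Fin N → EuclideanSpace ℝ (Fin n) → EuclideanSpace ℝ (Fin m) → ℝ → ℝ →
    EuclideanSpace ℝ (Fin n)}
  {R : Fin N → EuclideanSpace ℝ (Fin n) → EuclideanSpace ℝ (Fin n)}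
  {Qu : Set (Fin N)} {τd τa N₀ T₀ T k : ℝ}

local notation "Hsw" => PTData.system (switchedData f R Qu τd τa N₀ T₀) T k

theorem zeroX_mem_targetSet {z : WithLp 2 (SwitchState n × ℝ)} (hz : z ∈ (Hsw).C) :
    zeroX z ∈ targetSet (switchedTarget N n N₀ T₀) :=
  ⟨⟨rfl, hz.1⟩, hz.2⟩

/-- At a point of the flow set the other coordinates already lie in their target ranges, so
replacing x by 0 gives a nearest point. -/
theorem infDist_targetSet_eq {z : WithLp 2 (SwitchState n × ℝ)} (hz : z ∈ (Hsw).C) :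
    Metric.infDist z (targetSet (switchedTarget N n N₀ T₀)) = ‖z.fst.x‖ :=
  le_antisymm ((Metric.infDist_le_dist_of_mem (zeroX_mem_targetSet hz)).trans (dist_zeroX z).le)
    (norm_x_le_infDist ⟨_, zeroX_mem_targetSet hz⟩)

theorem isClosed_flowSet : IsClosed (Hsw).C := by
  have h1 : (Hsw).C = (auxL n 0 ⁻¹' Icc 0 N₀ ∩ (auxL n 1 ⁻¹' Icc 0 T₀ ∩
      auxL n 2 ⁻¹' range (modeLabel (N := N)))) ∩ μL n ⁻¹' Ici 1 := rfl
  rw [h1]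
  exact ((isClosed_Icc.preimage (auxL n 0).continuous).inter
    ((isClosed_Icc.preimage (auxL n 1).continuous).inter
      ((finite_range _).isClosed.preimage (auxL n 2).continuous))).inter
    (isClosed_Ici.preimage (μL n).continuous)

/-! ### Invariance of the flow set and the gain along solutions -/

variable {E : Set (ℝ × ℕ)} {z : ℝ → ℕ → WithLp 2 (SwitchState n × ℝ)}
  {u : ℝ → ℕ → EuclideanSpace ℝ (Fin m)}

theorem nonempty_interior_of_Icc_subset {I : Set ℝ} {a b : ℝ} (hab : a < b)
    (hsub : Icc a b ⊆ I) : (interior I).Nonempty := by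
  have h : (interior (Icc a b)).Nonempty := by rwa [interior_Icc, nonempty_Ioo]
  exact h.mono (interior_mono hsub)

theorem IsHybridArc.absolutelyContinuousOnInterval {Z : Type*} [PseudoMetricSpace Z]
    {z : ℝ → ℕ → Z} (h : IsHybridArc E z) {j : ℕ} {a b : ℝ} (hab : a < b)
    (hsub : Icc a b ⊆ flowInterval E j) :
    AbsolutelyContinuousOnInterval (fun t => z t j) a b :=
  h j (nonempty_interior_of_Icc_subset hab hsub) a (hsub ⟨le_rfl, hab.le⟩) b
    (hsub ⟨hab.le, le_rfl⟩)

theorem IsSolutionPair.flow_Icc {Z U : Type*} [NormedAddCommGroup Z] [NormedSpace ℝ Z]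
    [NormedAddCommGroup U] {H : HybridSystem Z U} {z : ℝ → ℕ → Z} {u : ℝ → ℕ → U}
    (h : IsSolutionPair H E z u) {j : ℕ} {a b : ℝ} (hab : a < b)
    (hsub : Icc a b ⊆ flowInterval E j) :
    ∀ᵐ t ∂volume.restrict (Icc a b), z t j ∈ H.C ∧
      ∃ v ∈ H.F (z t j) (u t j), HasDerivAt (fun s => z s j) v t :=
  ae_restrict_of_ae_restrict_of_subset hsub
    (h.flow j (nonempty_interior_of_Icc_subset hab hsub))

/-- A subset of full measure is dense in the interval, so continuity and closedness extend the
membership to every point, end points included. -/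
theorem mem_of_ae_mem_of_continuousOn {Z : Type*} [TopologicalSpace Z] {g : ℝ → Z} {S : Set Z}
    (hS : IsClosed S) {a b : ℝ} (hab : a < b) (hg : ContinuousOn g (Icc a b))
    (h : ∀ᵐ t ∂volume.restrict (Icc a b), g t ∈ S) : ∀ t ∈ Icc a b, g t ∈ S := by
  have hdense : Ioo a b ⊆ closure {t | t ∈ Ioo a b ∧ g t ∈ S} := by
    intro t ht
    rw [mem_closure_iff]
    intro o ho hto
    by_contra hcon
    have hpos : 0 < volume (o ∩ Ioo a b) := (ho.inter isOpen_Ioo).measure_pos _ ⟨t, hto, ht⟩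
    have hzero : volume (o ∩ Ioo a b) = 0 := by
      rw [ae_restrict_iff' measurableSet_Icc] at h
      refine measure_mono_null (fun s hs => ?_) h
      simp only [mem_compl_iff, mem_ofPred_eq, Classical.not_imp]
      exact ⟨Ioo_subset_Icc_self hs.2, fun hgs => hcon ⟨s, hs.1, hs.2, hgs⟩⟩
    exact hpos.ne' hzero
  have hclosed : IsClosed (Icc a b ∩ g ⁻¹' S) := hg.preimage_isClosed_of_isClosed isClosed_Icc hS
  have h1 : closure {t | t ∈ Ioo a b ∧ g t ∈ S} ⊆ Icc a b ∩ g ⁻¹' S :=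
    closure_minimal (fun t ht => ⟨Ioo_subset_Icc_self ht.1, ht.2⟩) hclosed
  have h2 : Icc a b ⊆ closure {t | t ∈ Ioo a b ∧ g t ∈ S} := by
    rw [← closure_Ioo hab.ne]
    exact closure_minimal hdense isClosed_closure
  exact fun t ht => (h1 (h2 ht)).2

theorem IsSolutionPair.mem_flowSet_Icc (h : IsSolutionPair (Hsw) E z u) {j : ℕ} {a b : ℝ}
    (hab : a < b) (hsub : Icc a b ⊆ flowInterval E j) : ∀ t ∈ Icc a b, z t j ∈ (Hsw).C := by
  refine mem_of_ae_mem_of_continuousOn isClosed_flowSet hab ?_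
    ((h.flow_Icc hab hsub).mono fun t ht => ht.1)
  have := (h.isHybridArc.absolutelyContinuousOnInterval hab hsub).continuousOn
  rwa [uIcc_of_le hab.le] at this

theorem IsSolutionPair.mem_flowSet_zero (h : IsSolutionPair (Hsw) E z u) : z 0 0 ∈ (Hsw).C := by
  rcases h.init with h | h
  · exact h
  · exact ⟨⟨⟨zero_le_one.trans h.1.1.1, h.1.1.2⟩, h.1.2⟩, h.2⟩

/-- The flow condition says nothing on one-point intervals; there membership comes from the initial
condition or from a jump, which needs τ ≥ 1 so that τ - 1 stays in [0, N₀]. -/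
theorem IsSolutionPair.mem_flowSet (h : IsSolutionPair (Hsw) E z u) :
    ∀ j t, (t, j) ∈ E → z t j ∈ (Hsw).C := by
  refine h.isHTD.induction h.zero_mem (P := fun t j => z t j ∈ (Hsw).C) h.mem_flowSet_zero ?_ ?_
  · intro j s t hst _ _ hsub _
    exact h.mem_flowSet_Icc hst hsub t ⟨hst.le, le_rfl⟩
  · intro t j h1 h2 _
    obtain ⟨hD, ⟨i, i', hi, hi', hne, hx, hτ, hρ⟩, hμ⟩ := h.jump t j h1 h2
    refine ⟨⟨?_, ?_, ?_⟩, ?_⟩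
    · rw [hτ]
      exact ⟨by linarith [hD.1.1.1], by linarith [hD.1.1.2]⟩
    · rw [hρ]; exact hD.1.2.1
    · exact ⟨i', hi'.symm⟩
    · rw [hμ]; exact hD.2

/-- Along solutions, `μ^{-1/k}` decreases with slope `-1/T`. -/
theorem IsSolutionPair.rpow_blowUpGain (hT : 0 < T) (hk : 1 ≤ k)
    (h : IsSolutionPair (Hsw) E z u) :
    ∀ j t, (t, j) ∈ E → (z t j).snd ^ (-(1 / k)) = (z 0 0).snd ^ (-(1 / k)) - t / T := by
  have hk0 : 0 < k := by linarith
  refine h.isHTD.induction h.zero_mem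
    (P := fun t j => (z t j).snd ^ (-(1 / k)) = (z 0 0).snd ^ (-(1 / k)) - t / T) (by simp) ?_ ?_
  · intro j a b hab _ _ hsub ha
    have hμ : AbsolutelyContinuousOnInterval (fun t => (z t j).snd) a b :=
      (μL n).comp_absolutelyContinuousOnInterval
        (h.isHybridArc.absolutelyContinuousOnInterval hab hsub)
    have hmem := h.mem_flowSet_Icc hab hsub
    have hpow : AbsolutelyContinuousOnInterval (fun t => (z t j).snd ^ (-(1 / k))) a b :=
      (contDiffOn_id.rpow_const_of_ne
        fun x (hx : x ∈ Ici (1 : ℝ)) => (zero_lt_one.trans_le hx).ne'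
        ).comp_absolutelyContinuousOnInterval (convex_Ici 1) isClosed_Ici hμ
        (by rw [uIcc_of_le hab.le]; exact fun t ht => (hmem t ht).2)
    have hd : ∀ᵐ t ∂volume.restrict (Icc a b),
        HasDerivAt (fun t => (z t j).snd ^ (-(1 / k))) (-1 / T) t := by
      filter_upwards [h.flow_Icc hab hsub] with t ⟨hC, v, hv, hvd⟩
      have hm : (1 : ℝ) ≤ (z t j).snd := hC.2
      have hm0 : 0 < (z t j).snd := by linarith
      have h1 : HasDerivAt (fun s => (z s j).snd) v.snd t :=
        (μL n).hasFDerivAt.comp_hasDerivAt t hvd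
      rw [hv.2] at h1
      convert! h1.rpow_const (p := -(1 / k)) (Or.inl hm0.ne') using 1
      have h2 : (z t j).snd ^ (1 + 1 / k) * (z t j).snd ^ (-(1 / k) - 1) = 1 := by
        rw [← Real.rpow_add hm0, show 1 + 1 / k + (-(1 / k) - 1) = 0 by ring, Real.rpow_zero]
      calc -1 / T = k / T * -(1 / k) * 1 := by field_simp
        _ = k / T * -(1 / k) * ((z t j).snd ^ (1 + 1 / k) * (z t j).snd ^ (-(1 / k) - 1)) := by
          rw [h2]
        _ = _ := by ring
    -- The mean value inequality for the function and for its negative gives equality.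
    have h1 := hpow.sub_le_of_ae_hasDerivAt_le hab.le (hd.mono fun t ht => ⟨_, le_rfl, ht⟩)
    have h2 := hpow.fun_neg.sub_le_of_ae_hasDerivAt_le hab.le
      (hd.mono fun t ht => ⟨_, le_rfl, ht.neg⟩)
    have h3 : -1 / T * (b - a) = a / T - b / T := by ring
    have h4 : -(-1 / T) * (b - a) = b / T - a / T := by ring
    rw [h3] at h1
    rw [h4] at h2
    linarith
  · intro t j h1 h2 hP
    rw [(h.jump t j h1 h2).2.2, hP]

/-- The affine law for μ^(-1/k) reads Υ - t = T μ^(-1/k). The right side is positive, so t < Υ on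
the whole domain and the power can be inverted. -/
theorem IsSolutionPair.snd_eq_blowUpGain (hT : 0 < T) (hk : 1 ≤ k)
    (h : IsSolutionPair (Hsw) E z u) {t : ℝ} {j : ℕ} (hmem : (t, j) ∈ E) :
    (z t j).snd = blowUpGain T k (z 0 0).snd t := by
  have hk0 : k ≠ 0 := by linarith
  have hm : (1 : ℝ) ≤ (z t j).snd := (h.mem_flowSet j t hmem).2
  have h1 := h.rpow_blowUpGain hT hk j t hmem
  have h2 : 0 < (z t j).snd ^ (-(1 / k)) := Real.rpow_pos_of_pos (by linarith) _
  have h3 : prescribedTime T k (z 0 0).snd - t = T * (z t j).snd ^ (-(1 / k)) := by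
    rw [h1, prescribedTime]; field_simp
  rw [blowUpGain, h3, Real.mul_rpow hT.le h2.le, ← Real.rpow_mul (by linarith)]
  have h4 : -(1 / k) * k = -1 := by field_simp
  rw [h4, Real.rpow_neg_one]
  have : T ^ k ≠ 0 := (Real.rpow_pos_of_pos hT _).ne'
  field_simp

theorem IsSolutionPair.le_snd (hT : 0 < T) (hk : 1 ≤ k)
    (h : IsSolutionPair (Hsw) E z u) {t : ℝ} {j : ℕ} (hmem : (t, j) ∈ E) :
    (z 0 0).snd ≤ (z t j).snd := by
  have hm : (1 : ℝ) ≤ (z t j).snd := (h.mem_flowSet j t hmem).2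
  have hm0 : (1 : ℝ) ≤ (z 0 0).snd := (h.mem_flowSet_zero).2
  have h1 := h.rpow_blowUpGain hT hk j t hmem
  have ht : 0 ≤ t / T := div_nonneg (h.isHTD.1 _ hmem) hT.le
  have hk0 : -(1 / k) < 0 := neg_neg_of_pos (by positivity)
  exact (Real.rpow_le_rpow_iff_of_neg (by linarith) (by linarith) hk0).1
    (by linarith : (z t j).snd ^ (-(1 / k)) ≤ _)

/-! ## The Lyapunov estimate -/

variable {Δ : ℝ → ℝ} {V : Fin N → EuclideanSpace ℝ (Fin n) → ℝ → ℝ}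
  {c₁ c₂ c₃ c₄ c₅ : Fin N → ℝ} {p χ : ℝ}

/-- The Lyapunov function `V_q(x, τ) exp(A τ + B ρ)` of the switching system in mode `i`. -/
noncomputable def switchedLyapunov {N n : ℕ} (V : Fin N → EuclideanSpace ℝ (Fin n) → ℝ → ℝ)
    (A B : ℝ) (i : Fin N) (ψ : SwitchState n) : ℝ :=
  V i ψ.x ψ.τ * Real.exp (A * ψ.τ + B * ψ.ρ)

/-- The mode is constant along flows. -/
theorem IsSolutionPair.q_eq (h : IsSolutionPair (Hsw) E z u) {j : ℕ} {a b : ℝ}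
    (hsub : Icc a b ⊆ flowInterval E j) : ∀ t ∈ Icc a b, (z t j).fst.q = (z a j).fst.q := by
  intro t ht
  rcases ht.1.eq_or_lt with rfl | hat
  · rfl
  have hsub' : Icc a t ⊆ flowInterval E j := (Icc_subset_Icc_right ht.2).trans hsub
  have hq : AbsolutelyContinuousOnInterval (fun t => (z t j).fst.q) a t :=
    (auxL n 2).comp_absolutelyContinuousOnInterval
      (h.isHybridArc.absolutelyContinuousOnInterval hat hsub')
  have hd : ∀ᵐ s ∂volume.restrict (Icc a t), HasDerivAt (fun s => (z s j).fst.q) 0 s := by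
    filter_upwards [h.flow_Icc hat hsub'] with s ⟨_, v, ⟨⟨w, ⟨i, _, _, _, _, hw⟩, hvw⟩, _⟩, hvd⟩
    have h1 : HasDerivAt (fun s => (z s j).fst.q) v.fst.q s :=
      (auxL n 2).hasFDerivAt.comp_hasDerivAt s hvd
    have h2 : v.fst.q = 0 := by
      rw [hvw]
      change (z s j).snd * w.q = 0
      rw [hw, mul_zero]
    rwa [h2] at h1
  have h1 := hq.sub_le_of_ae_hasDerivAt_le hat.le (hd.mono fun s hs => ⟨_, le_rfl, hs⟩)
  have h2 := hq.fun_neg.sub_le_of_ae_hasDerivAt_le hat.le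
    (hd.mono fun s hs => ⟨_, le_rfl, hs.neg⟩)
  simp only [neg_zero, zero_mul] at h1 h2
  linarith

/-- The chain rule for `V_q` along a path with values in `τ ≥ 0`. -/
theorem hasDerivAt_comp_lyapunov {V : EuclideanSpace ℝ (Fin n) → ℝ → ℝ}
    (hV : ContDiffOn ℝ ∞ (fun w : EuclideanSpace ℝ (Fin n) × ℝ => V w.1 w.2) (univ ×ˢ Ici 0))
    {x : ℝ → EuclideanSpace ℝ (Fin n)} {τ : ℝ → ℝ} {v : EuclideanSpace ℝ (Fin n)}
    {η μ t : ℝ} (hτ : ∀ᶠ s in 𝓝 t, 0 ≤ τ s) (hx : HasDerivAt x (μ • v) t)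
    (hτd : HasDerivAt τ (μ * η) t) :
    HasDerivAt (fun s => V (x s) (τ s)) (μ * lieDerivative V (x t) (τ t) v η) t := by
  have h1 := ((hV.differentiableOn (by simp)) (x t, τ t)
    ⟨mem_univ _, hτ.self_of_nhds⟩).hasFDerivWithinAt
  have h2 := h1.comp_hasDerivAt (f := fun s => (x s, τ s)) t (hx.prodMk hτd)
    (hτ.mono fun s hs => ⟨mem_univ _, hs⟩)
  convert! h2 using 1
  rw [show (μ • v, μ * η) = μ • (v, η) from rfl, map_smul, smul_eq_mul]
  rfl

/-- The decay rate of the Lyapunov function at a point of a flow. -/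
theorem LyapunovAssumption.deriv_le
    (hL : LyapunovAssumption f R Qu τd N₀ Δ V c₁ c₂ c₃ c₄ c₅ p χ)
    {ℓ A c C₃ C₄ C₅ U : ℝ} (hA : 0 ≤ A)
    (hΔ : ∀ μ, 1 ≤ μ → Δ μ ≤ μ ^ (-ℓ))
    (h3 : ∀ q, C₃ ≤ c₃ q) (h4 : ∀ q, c₄ q ≤ C₄) (h5 : ∀ q, c₅ q ≤ C₅) (hB : 0 ≤ C₃ + C₅)
    (hrate : -C₃ + A * (1 / τd) + (C₃ + C₅) * (1 / τa) ≤ -c)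
    {i : Fin N} {x : EuclideanSpace ℝ (Fin n)} {v : EuclideanSpace ℝ (Fin m)} {τ ρ μ η σ : ℝ}
    (hτ : τ ∈ Icc 0 N₀) (hρ : ρ ∈ Icc 0 T₀) (hμ : 1 ≤ μ) (hη : η ∈ Icc 0 (1 / τd))
    (hσ : σ ∈ Icc 0 (1 / τa)) (hv : ‖v‖ ≤ U) :
    μ * lieDerivative (V i) x τ (f i x v τ μ) η * Real.exp (A * τ + (C₃ + C₅) * ρ) +
      V i x τ * (Real.exp (A * τ + (C₃ + C₅) * ρ) * (A * (μ * η) +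
        (C₃ + C₅) * (μ * (σ - Qu.indicator (fun _ => (1 : ℝ)) i)))) ≤
    μ * (-c * (V i x τ * Real.exp (A * τ + (C₃ + C₅) * ρ)) +
      C₄ * Real.exp (A * N₀ + (C₃ + C₅) * T₀) * U ^ p * μ ^ (-ℓ)) := by
  have hV : 0 ≤ V i x τ := hL.nonneg i x τ hτ.1
  have hη' : η ∈ Icc 0 τd⁻¹ := by rwa [inv_eq_one_div]
  have hc4 : 0 < c₄ i := (hL.c_pos i).2.2.2.1
  have hμp : 0 ≤ μ ^ (-ℓ) := Real.rpow_nonneg (by linarith) _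
  have hup : 0 ≤ ‖v‖ ^ p := by positivity
  have hU : 0 ≤ U := (norm_nonneg v).trans hv
  have hC4 : 0 ≤ C₄ := hc4.le.trans (h4 i)
  have hin : c₄ i * Δ μ * ‖v‖ ^ p ≤ C₄ * μ ^ (-ℓ) * U ^ p :=
    calc c₄ i * Δ μ * ‖v‖ ^ p ≤ c₄ i * μ ^ (-ℓ) * ‖v‖ ^ p := by gcongr; exact hΔ μ hμ
      _ ≤ C₄ * μ ^ (-ℓ) * U ^ p := by
        have := h4 i
        have := hL.p_pos
        gcongr
  have hkey : lieDerivative (V i) x τ (f i x v τ μ) η + V i x τ * (A * η +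
      (C₃ + C₅) * (σ - Qu.indicator (fun _ => (1 : ℝ)) i)) ≤
      -c * V i x τ + C₄ * μ ^ (-ℓ) * U ^ p := by
    have e1 : A * η ≤ A * (1 / τd) := mul_le_mul_of_nonneg_left hη.2 hA
    have e2 : (C₃ + C₅) * σ ≤ (C₃ + C₅) * (1 / τa) := mul_le_mul_of_nonneg_left hσ.2 hB
    -- In an unstable mode C₅ - (C₃ + C₅) = -C₃, so both cases end with the same rate.
    by_cases hi : i ∈ Qu
    · have := hL.unstable i hi x v τ hτ μ hμ η hη'
      rw [indicator_of_mem hi]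
      have h6 : V i x τ * (c₅ i + A * η + (C₃ + C₅) * σ - (C₃ + C₅)) ≤ V i x τ * (-c) :=
        mul_le_mul_of_nonneg_left (by linarith [h5 i]) hV
      linarith
    · have := hL.stable i hi x v τ hτ μ hμ η hη'
      rw [indicator_of_notMem hi]
      have h6 : V i x τ * (-c₃ i + A * η + (C₃ + C₅) * σ) ≤ V i x τ * (-c) :=
        mul_le_mul_of_nonneg_left (by linarith [h3 i]) hV
      linarith
  -- Only the input term needs the exponential weight replaced by its maximum; in the decay term it
  -- is part of the Lyapunov function.
  have hexp : Real.exp (A * τ + (C₃ + C₅) * ρ) ≤ Real.exp (A * N₀ + (C₃ + C₅) * T₀) := by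
    have := hτ.2
    have := hρ.2
    gcongr
  have hD : 0 ≤ C₄ * μ ^ (-ℓ) * U ^ p := by positivity
  set e := Real.exp (A * τ + (C₃ + C₅) * ρ)
  set e' := Real.exp (A * N₀ + (C₃ + C₅) * T₀)
  have he : 0 < e := Real.exp_pos _
  have hμ0 : 0 ≤ μ := by linarith
  calc _ = μ * (e * (lieDerivative (V i) x τ (f i x v τ μ) η + V i x τ * (A * η +
      (C₃ + C₅) * (σ - Qu.indicator (fun _ => (1 : ℝ)) i)))) := by ring
    _ ≤ μ * (e * (-c * V i x τ + C₄ * μ ^ (-ℓ) * U ^ p)) := by gcongr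
    _ = μ * (-c * (V i x τ * e) + e * (C₄ * μ ^ (-ℓ) * U ^ p)) := by ring
    _ ≤ μ * (-c * (V i x τ * e) + e' * (C₄ * μ ^ (-ℓ) * U ^ p)) := by gcongr
    _ = _ := by ring

/-- The Lyapunov estimate along a flow. -/
theorem LyapunovAssumption.flow_estimate
    (hL : LyapunovAssumption f R Qu τd N₀ Δ V c₁ c₂ c₃ c₄ c₅ p χ)
    {ℓ ν A c C₃ C₄ C₅ U μ₀ : ℝ} (hT : 0 < T) (hk : 1 ≤ k) (hA : 0 ≤ A) (hc : 0 < c)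
    (hU : 0 ≤ U) (hC4 : 0 ≤ C₄)
    (hΔ : ∀ μ, 1 ≤ μ → Δ μ ≤ μ ^ (-ℓ)) (hνℓ : ν ≤ ℓ) (hνc : ν * (k / T) ≤ c / 2)
    (h3 : ∀ q, C₃ ≤ c₃ q) (h4 : ∀ q, c₄ q ≤ C₄) (h5 : ∀ q, c₅ q ≤ C₅) (hB : 0 ≤ C₃ + C₅)
    (hrate : -C₃ + A * (1 / τd) + (C₃ + C₅) * (1 / τa) ≤ -c)
    (h : IsSolutionPair (Hsw) E z u) {j : ℕ} {a b : ℝ} (hab : a < b)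
    (hsub : Icc a b ⊆ flowInterval E j) (hu : ∀ t ∈ Icc a b, ‖u t j‖ ≤ U)
    {i : Fin N} (hi : (z a j).fst.q = modeLabel i) :
    Real.exp (c * omegaFun T k (z b j).snd μ₀) * (switchedLyapunov V A (C₃ + C₅) i (z b j).fst -
        2 * (C₄ * Real.exp (A * N₀ + (C₃ + C₅) * T₀) * U ^ p) / c * (z b j).snd ^ (-ν)) ≤
      Real.exp (c * omegaFun T k (z a j).snd μ₀) *
        (switchedLyapunov V A (C₃ + C₅) i (z a j).fst -
        2 * (C₄ * Real.exp (A * N₀ + (C₃ + C₅) * T₀) * U ^ p) / c * (z a j).snd ^ (-ν)) := by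
  have hz := h.isHybridArc.absolutelyContinuousOnInterval hab hsub
  have hμ : AbsolutelyContinuousOnInterval (fun t => (z t j).snd) a b :=
    (μL n).comp_absolutelyContinuousOnInterval hz
  have hx : AbsolutelyContinuousOnInterval (fun t => (z t j).fst.x) a b :=
    (xL n).comp_absolutelyContinuousOnInterval hz
  have hτ : AbsolutelyContinuousOnInterval (fun t => (z t j).fst.τ) a b :=
    (auxL n 0).comp_absolutelyContinuousOnInterval hz
  have hρ : AbsolutelyContinuousOnInterval (fun t => (z t j).fst.ρ) a b :=
    (auxL n 1).comp_absolutelyContinuousOnInterval hz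
  have hmem := h.mem_flowSet_Icc hab hsub
  have hτ0 : ∀ t ∈ uIcc a b, 0 ≤ (z t j).fst.τ := by
    rw [uIcc_of_le hab.le]
    exact fun t ht => (hmem t ht).1.1.1
  have hV : AbsolutelyContinuousOnInterval (fun t => V i (z t j).fst.x (z t j).fst.τ) a b :=
    ContDiffOn.comp_prodMk_absolutelyContinuousOnInterval ((hL.smooth i).of_le (by simp)) hx hτ hτ0
  have he : AbsolutelyContinuousOnInterval
      (fun t => Real.exp (A * (z t j).fst.τ + (C₃ + C₅) * (z t j).fst.ρ)) a b :=
    (Real.contDiff_exp.contDiffOn (s := univ)).comp_absolutelyContinuousOnInterval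
      convex_univ isClosed_univ ((hτ.const_mul A).fun_add (hρ.const_mul (C₃ + C₅)))
      fun _ _ => mem_univ _
  have hflow := h.flow_Icc hab hsub
  have hw : AbsolutelyContinuousOnInterval
      (fun t => switchedLyapunov V A (C₃ + C₅) i (z t j).fst) a b := hV.fun_mul he
  have hμ1 : ∀ t ∈ Icc a b, 1 ≤ (z t j).snd := fun t ht => (hmem t ht).2
  have hD : 0 ≤ C₄ * Real.exp (A * N₀ + (C₃ + C₅) * T₀) * U ^ p := by positivity
  have hμd : ∀ᵐ t ∂volume.restrict (Icc a b),
      HasDerivAt (fun s => (z s j).snd) (k / T * (z t j).snd ^ (1 + 1 / k)) t := by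
    filter_upwards [hflow] with t ⟨_, v, hv, hvd⟩
    have h1 : HasDerivAt (fun s => (z s j).snd) v.snd t :=
      (μL n).hasFDerivAt.comp_hasDerivAt t hvd
    rwa [hv.2] at h1
  have hwd : ∀ᵐ t ∂volume.restrict (Icc a b), ∃ w' ≤ (z t j).snd *
      (-c * switchedLyapunov V A (C₃ + C₅) i (z t j).fst +
        C₄ * Real.exp (A * N₀ + (C₃ + C₅) * T₀) * U ^ p * (z t j).snd ^ (-ℓ)),
      HasDerivAt (fun s => switchedLyapunov V A (C₃ + C₅) i (z s j).fst) w' t := by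
    -- At interior times τ ≥ 0 holds in a whole neighbourhood, as the chain rule for the one-sided
    -- derivative at τ = 0 requires.
    rw [← Measure.restrict_congr_set Ioo_ae_eq_Icc] at hflow ⊢
    filter_upwards [hflow, ae_restrict_mem measurableSet_Ioo]
      with t ⟨hC, v, ⟨⟨w, ⟨i', hi', hwx, hwτ, ⟨σ, hσ, hwρ⟩, _⟩, hvw⟩, _⟩, hvd⟩ ht
    have hii : i' = i := modeLabel_injective
      (by rw [← hi', h.q_eq hsub t (Ioo_subset_Icc_self ht), hi])
    subst hii
    have hxd : HasDerivAt (fun s => (z s j).fst.x) ((z t j).snd • w.x) t := by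
      have h1 : HasDerivAt (fun s => (z s j).fst.x) v.fst.x t :=
        (xL n).hasFDerivAt.comp_hasDerivAt t hvd
      rwa [hvw] at h1
    have hτ' : HasDerivAt (fun s => (z s j).fst.τ) ((z t j).snd * w.τ) t := by
      have h1 : HasDerivAt (fun s => (z s j).fst.τ) v.fst.τ t :=
        (auxL n 0).hasFDerivAt.comp_hasDerivAt t hvd
      rwa [hvw] at h1
    have hρ' : HasDerivAt (fun s => (z s j).fst.ρ) ((z t j).snd * w.ρ) t := by
      have h1 : HasDerivAt (fun s => (z s j).fst.ρ) v.fst.ρ t :=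
        (auxL n 1).hasFDerivAt.comp_hasDerivAt t hvd
      rwa [hvw] at h1
    have hev : ∀ᶠ s in 𝓝 t, 0 ≤ (z s j).fst.τ := by
      filter_upwards [Ioo_mem_nhds ht.1 ht.2] with s hs
      exact (hmem s (Ioo_subset_Icc_self hs)).1.1.1
    have hVd := hasDerivAt_comp_lyapunov (hL.smooth i') hev hxd hτ'
    have hed := ((hτ'.const_mul A).fun_add (hρ'.const_mul (C₃ + C₅))).exp
    rw [hwx] at hVd
    rw [hwρ] at hed
    have hrate' := hL.deriv_le (i := i') (x := (z t j).fst.x) hA hΔ h3 h4 h5 hB hrate hC.1.1 hC.1.2.1 hC.2 hwτ hσ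
      (hu t (Ioo_subset_Icc_self ht))
    unfold switchedLyapunov
    exact ⟨_, hrate', hVd.fun_mul hed⟩
  exact comparison_blowUp (w := fun t => switchedLyapunov V A (C₃ + C₅) i (z t j).fst)
    (μ := fun t => (z t j).snd) (a := a) (b := b) hT hk hc hD hνℓ hνc hab.le hw hμ hμ1 hμd hwd

/-- The Lyapunov function decreases by the factor `exp(-A)` at jumps. -/
theorem LyapunovAssumption.jump_estimate
    (hL : LyapunovAssumption f R Qu τd N₀ Δ V c₁ c₂ c₃ c₄ c₅ p χ) {A B : ℝ}
    {ζ ζ' : WithLp 2 (SwitchState n × ℝ)} (hD : ζ ∈ (Hsw).D) (hG : ζ' ∈ (Hsw).G ζ) :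
    ∃ i, ζ.fst.q = modeLabel i ∧ ∀ i', ζ'.fst.q = modeLabel i' →
      switchedLyapunov V A B i' ζ'.fst ≤
        Real.exp (-A) * switchedLyapunov V A B i ζ.fst := by
  obtain ⟨⟨i, i', hi, hi', hne, hx, hτ, hρ⟩, _⟩ := hG
  refine ⟨i, hi, fun i'' hi'' => ?_⟩
  obtain rfl : i'' = i' := modeLabel_injective (hi''.symm.trans hi')
  have h1 := hL.reset i i'' hne ζ.fst.x ζ.fst.τ hD.1.1
  have h0 : 0 ≤ V i ζ.fst.x ζ.fst.τ := hL.nonneg i _ _ (zero_le_one.trans hD.1.1.1)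
  have h2 : χ * V i ζ.fst.x ζ.fst.τ ≤ V i ζ.fst.x ζ.fst.τ :=
    mul_le_of_le_one_left h0 hL.χ_mem.2
  unfold switchedLyapunov
  rw [hx, hτ, hρ]
  have h3 : Real.exp (A * (ζ.fst.τ - 1) + B * ζ.fst.ρ) =
      Real.exp (-A) * Real.exp (A * ζ.fst.τ + B * ζ.fst.ρ) := by
    rw [← Real.exp_add]; ring_nf
  rw [h3]
  calc _ ≤ V i ζ.fst.x ζ.fst.τ * (Real.exp (-A) * Real.exp (A * ζ.fst.τ + B * ζ.fst.ρ)) := by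
        gcongr; exact h1.trans h2
    _ = _ := by ring

/-- The Lyapunov estimate along solutions. -/
theorem LyapunovAssumption.solution_estimate
    (hL : LyapunovAssumption f R Qu τd N₀ Δ V c₁ c₂ c₃ c₄ c₅ p χ)
    {ℓ ν A c C₂ C₃ C₄ C₅ U : ℝ} (hT : 0 < T) (hk : 1 ≤ k) (hA : 0 ≤ A) (hc : 0 < c)
    (hU : 0 ≤ U) (hC4 : 0 ≤ C₄)
    (hΔ : ∀ μ, 1 ≤ μ → Δ μ ≤ μ ^ (-ℓ)) (hνℓ : ν ≤ ℓ) (hνc : ν * (k / T) ≤ c / 2)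
    (h2 : ∀ q, c₂ q ≤ C₂)
    (h3 : ∀ q, C₃ ≤ c₃ q) (h4 : ∀ q, c₄ q ≤ C₄) (h5 : ∀ q, c₅ q ≤ C₅) (hB : 0 ≤ C₃ + C₅)
    (hrate : -C₃ + A * (1 / τd) + (C₃ + C₅) * (1 / τa) ≤ -c)
    (h : IsSolutionPair (Hsw) E z u) {t₀ : ℝ} {j₀ : ℕ}
    (hu : ∀ t j, (t, j) ∈ E → t ≤ t₀ → j ≤ j₀ → ‖u t j‖ ≤ U) :
    ∀ j t, (t, j) ∈ E → t ≤ t₀ → j ≤ j₀ → ∀ i, (z t j).fst.q = modeLabel i →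
      switchedLyapunov V A (C₃ + C₅) i (z t j).fst ≤
        Real.exp (-(c * omegaFun T k (z t j).snd (z 0 0).snd)) * Real.exp (-(A * j)) *
          (C₂ * ‖(z 0 0).fst.x‖ ^ p * Real.exp (A * N₀ + (C₃ + C₅) * T₀)) +
        2 * (C₄ * Real.exp (A * N₀ + (C₃ + C₅) * T₀) * U ^ p) / c * (z t j).snd ^ (-ν) := by
  have hM : 0 ≤ 2 * (C₄ * Real.exp (A * N₀ + (C₃ + C₅) * T₀) * U ^ p) / c := by positivity
  have hfs := h.mem_flowSet
  have hmp : ∀ j t, (t, j) ∈ E → 0 ≤ (z t j).snd ^ (-ν) := fun j t ht =>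
    Real.rpow_nonneg (zero_le_one.trans (hfs j t ht).2) _
  refine h.isHTD.induction h.zero_mem ?_ ?_ ?_
  · intro _ _ i hi
    have hC := hfs 0 0 h.zero_mem
    have h6 : switchedLyapunov V A (C₃ + C₅) i (z 0 0).fst ≤
        C₂ * ‖(z 0 0).fst.x‖ ^ p * Real.exp (A * N₀ + (C₃ + C₅) * T₀) := by
      have h7 := (hL.bounds i (z 0 0).fst.x (z 0 0).fst.τ hC.1.1).2
      have h8 := h2 i
      have h9 : 0 < c₂ i := (hL.c_pos i).2.1
      have h10 : (z 0 0).fst.τ ≤ N₀ := hC.1.1.2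
      have h11 : (z 0 0).fst.ρ ≤ T₀ := hC.1.2.1.2
      have h12 : 0 ≤ ‖(z 0 0).fst.x‖ ^ p := by positivity
      have h13 : 0 ≤ V i (z 0 0).fst.x (z 0 0).fst.τ := hL.nonneg _ _ _ hC.1.1.1
      unfold switchedLyapunov
      have h14 : 0 ≤ C₂ := h9.le.trans h8
      calc _ ≤ (c₂ i * ‖(z 0 0).fst.x‖ ^ p) * Real.exp (A * N₀ + (C₃ + C₅) * T₀) := by gcongr
        _ ≤ _ := by gcongr
    have h7 := mul_nonneg hM (hmp 0 0 h.zero_mem)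
    simp only [omegaFun_self, Nat.cast_zero, mul_zero, neg_zero, Real.exp_zero, one_mul]
    linarith
  · intro j a b hab ha hb hsub hP hbt hj i hi
    have hia : (z a j).fst.q = modeLabel i := by
      rw [← h.q_eq hsub b ⟨hab.le, le_rfl⟩, hi]
    have h6 := hP (hab.le.trans hbt) hj i hia
    have h7 := hL.flow_estimate (μ₀ := (z 0 0).snd) hT hk hA hc hU hC4 hΔ hνℓ hνc
      h3 h4 h5 hB hrate h hab hsub
      (fun t ht => hu t j (hsub ht) (ht.2.trans hbt) hj) hia
    rw [← sub_le_iff_le_add] at h6 ⊢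
    have h8 := h7.trans (mul_le_mul_of_nonneg_left h6 (Real.exp_nonneg _))
    have h9 : ∀ r s y : ℝ, Real.exp r * (Real.exp (-r) * s * y) = s * y := fun r s y => by
      rw [Real.exp_neg]; field_simp
    rw [h9] at h8
    refine le_of_mul_le_mul_left ?_ (Real.exp_pos (c * omegaFun T k (z b j).snd (z 0 0).snd))
    rwa [h9]
  · intro t j h6 h7 hP htt hj i' hi'
    obtain ⟨hD, hG⟩ := h.jump t j h6 h7
    obtain ⟨i, hi, hW⟩ := hL.jump_estimate (A := A) (B := C₃ + C₅) hD hG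
    have h8 := hP htt (by omega) i hi
    have h9 := (hW i' hi').trans (mul_le_mul_of_nonneg_left h8 (Real.exp_nonneg _))
    rw [hG.2]
    have h10 : Real.exp (-(A * ((j + 1 : ℕ) : ℝ))) = Real.exp (-A) * Real.exp (-(A * j)) := by
      rw [← Real.exp_add]; push_cast; ring_nf
    rw [h10]
    -- The input term need not shrink at a jump; it is enough that it does not grow.
    have h11 : Real.exp (-A) ≤ 1 := Real.exp_le_one_iff.2 (by linarith)
    have h12 := mul_le_of_le_one_left (mul_nonneg hM (hmp j t h6)) h11
    linarith

/-- Evaluating the two-sided bound at a unit vector gives c_{q,1} ≤ c_{q,2}; such a vector exists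
only for n ≠ 0. -/
theorem LyapunovAssumption.one_le_lyapunovRatio [Nonempty (Fin N)] [NeZero n]
    (hL : LyapunovAssumption f R Qu τd N₀ Δ V c₁ c₂ c₃ c₄ c₅ p χ) (hN₀ : 0 ≤ N₀) :
    1 ≤ lyapunovRatio c₁ c₂ := by
  obtain ⟨i⟩ := ‹Nonempty (Fin N)›
  have : Nonempty (Fin N) := ⟨i⟩
  obtain ⟨i₀, hi₀⟩ := exists_eq_ciInf_of_finite (f := c₁)
  have hpos : 0 < ⨅ q, c₁ q := hi₀ ▸ (hL.c_pos i₀).1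
  have hx : ‖(EuclideanSpace.single 0 1 : EuclideanSpace ℝ (Fin n))‖ = 1 := by simp
  have h := hL.bounds i (EuclideanSpace.single 0 1) 0 ⟨le_rfl, hN₀⟩
  rw [hx, Real.one_rpow, mul_one, mul_one] at h
  rw [lyapunovRatio, one_le_div hpos]
  exact (ciInf_le (Finite.bddBelow_range c₁) i).trans
    ((h.1.trans h.2).trans (le_ciSup (Finite.bddAbove_range c₂) i))

theorem IsSolutionPair.omegaFun_snd (hT : 0 < T) (hk : 1 ≤ k)
    (h : IsSolutionPair (Hsw) E z u) {t : ℝ} {j : ℕ} (hmem : (t, j) ∈ E) :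
    omegaFun T k (z t j).snd (z 0 0).snd = timeDilation T k (z 0 0).snd t := by
  rw [timeDilation, ← h.snd_eq_blowUpGain hT hk hmem]

theorem IsSolutionPair.timeDilation_nonneg (hT : 0 < T) (hk : 1 ≤ k)
    (h : IsSolutionPair (Hsw) E z u) {t : ℝ} {j : ℕ} (hmem : (t, j) ∈ E) :
    0 ≤ timeDilation T k (z 0 0).snd t :=
  h.omegaFun_snd hT hk hmem ▸
    omegaFun_nonneg hT hk h.mem_flowSet_zero.2 (h.le_snd hT hk hmem)

theorem IsSolutionPair.one_add_timeDilation_le (hT : 0 < T) (hk : 1 ≤ k)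
    (h : IsSolutionPair (Hsw) E z u) {t : ℝ} {j : ℕ} (hmem : (t, j) ∈ E) :
    1 + k / T * timeDilation T k (z 0 0).snd t ≤ (z t j).snd :=
  h.omegaFun_snd hT hk hmem ▸
    one_add_omegaFun_le hT hk h.mem_flowSet_zero.2 (h.le_snd hT hk hmem)

/-- Taking `p`-th roots in the Lyapunov estimate. -/
theorem le_of_rpow_le_mul_add {p K φ α β y : ℝ} (hp : 0 < p) (hK : 0 ≤ K) (hφ : 0 ≤ φ)
    (hα : 0 ≤ α) (hβ : 0 ≤ β) (hy : 0 ≤ y) (h : y ^ p ≤ K * φ * (α ^ p + β ^ p)) :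
    y ≤ (2 * K) ^ (1 / p) * φ ^ (1 / p) * (α + β) := by
  have hpp : 1 / p * p = 1 := by field_simp
  refine (Real.rpow_le_rpow_iff hy (by positivity) hp).1 ?_
  rw [Real.mul_rpow (by positivity) (by positivity), Real.mul_rpow (by positivity) (by positivity),
    ← Real.rpow_mul (by positivity), ← Real.rpow_mul hφ, hpp, Real.rpow_one, Real.rpow_one]
  -- Bounding each power separately, at the cost of a factor 2, works for every p > 0, including p <
  -- 1.
  have h1 : α ^ p ≤ (α + β) ^ p := by gcongr; linarith
  have h2 : β ^ p ≤ (α + β) ^ p := by gcongr; linarith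
  calc y ^ p ≤ K * φ * (α ^ p + β ^ p) := h
    _ ≤ K * φ * ((α + β) ^ p + (α + β) ^ p) := by gcongr
    _ = _ := by ring

/-- The estimate of `x` along all solutions. -/
theorem LyapunovAssumption.exists_norm_x_le [Nonempty (Fin N)]
    (hL : LyapunovAssumption f R Qu τd N₀ Δ V c₁ c₂ c₃ c₄ c₅ p χ)
    {ℓ : ℝ} (hℓ : 0 ≤ ℓ) (hT : 0 < T) (hk : 1 ≤ k) (hτd : 0 < τd) (hN₀ : 0 ≤ N₀)
    (hΔ : ∀ μ, 1 ≤ μ → Δ μ ≤ μ ^ (-ℓ))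
    (hcond : 1 > 1 / ((⨅ q, c₃ q) * τd) * Real.log (lyapunovRatio c₁ c₂)
      + 1 / τa * (1 + (⨆ q, c₅ q) / (⨅ q, c₃ q))) :
    ∃ C c A ν : ℝ, 0 < C ∧ 0 < c ∧ 0 < A ∧ 0 ≤ ν ∧ (0 < ℓ → 0 < ν) ∧
      ∀ E z u, IsSolutionPair (Hsw) E z u → ∀ t j, (t, j) ∈ E → ∀ U,
        (∀ a ∈ inputSizes E u t j, a ≤ U) →
        ‖(z t j).fst.x‖ ≤ (C * ‖(z 0 0).fst.x‖ * Real.exp (-(c * timeDilation T k (z 0 0).snd t)) *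
          Real.exp (-(A * j)) + C * U) *
            (1 + k / T * timeDilation T k (z 0 0).snd t) ^ (-ν) := by
  have hk0 : 0 < k := by linarith
  -- For n = 0 the bounds on V say nothing, and ln r may be negative; but then x = 0 and any
  -- constants work.
  rcases Nat.eq_zero_or_pos n with rfl | hn
  · refine ⟨1, 1, 1, ℓ, one_pos, one_pos, one_pos, hℓ, id, fun E z u h t j hmem U hU => ?_⟩
    have h1 := h.timeDilation_nonneg hT hk hmem
    have h2 : 0 ≤ U := (norm_nonneg _).trans (hU _ ⟨t, j, hmem, le_rfl, le_rfl, rfl⟩)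
    rw [Subsingleton.elim (z t j).fst.x 0, norm_zero]
    have h3 : 0 ≤ k / T * timeDilation T k (z 0 0).snd t := by positivity
    positivity
  have : NeZero n := ⟨hn.ne'⟩
  obtain ⟨i₃, hi₃⟩ := exists_eq_ciInf_of_finite (f := c₃)
  obtain ⟨i₁, hi₁⟩ := exists_eq_ciInf_of_finite (f := c₁)
  have hC1 : 0 < ⨅ q, c₁ q := hi₁ ▸ (hL.c_pos i₁).1
  have hC3 : 0 < ⨅ q, c₃ q := hi₃ ▸ (hL.c_pos i₃).2.2.1
  have h1 : ∀ q, (⨅ q, c₁ q) ≤ c₁ q := fun q => ciInf_le (Finite.bddBelow_range c₁) q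
  have h2 : ∀ q, c₂ q ≤ ⨆ q, c₂ q := fun q => le_ciSup (Finite.bddAbove_range c₂) q
  have h3 : ∀ q, (⨅ q, c₃ q) ≤ c₃ q := fun q => ciInf_le (Finite.bddBelow_range c₃) q
  have h4 : ∀ q, c₄ q ≤ ⨆ q, c₄ q := fun q => le_ciSup (Finite.bddAbove_range c₄) q
  have h5 : ∀ q, c₅ q ≤ ⨆ q, c₅ q := fun q => le_ciSup (Finite.bddAbove_range c₅) q
  have hC2 : 0 < ⨆ q, c₂ q := (hL.c_pos i₃).2.1.trans_le (h2 i₃)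
  have hC4 : 0 < ⨆ q, c₄ q := (hL.c_pos i₃).2.2.2.1.trans_le (h4 i₃)
  have hC5 : 0 < ⨆ q, c₅ q := (hL.c_pos i₃).2.2.2.2.trans_le (h5 i₃)
  have hr : 0 ≤ Real.log (lyapunovRatio c₁ c₂) := Real.log_nonneg (hL.one_le_lyapunovRatio hN₀)
  set C₁ := ⨅ q, c₁ q
  set C₂ := ⨆ q, c₂ q
  set C₃ := ⨅ q, c₃ q
  set C₄ := ⨆ q, c₄ q
  set C₅ := ⨆ q, c₅ q
  -- Dropping the nonnegative ln r term and multiplying the condition by C₃ shows that the gap 2c is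
  -- positive. Half of it is spent on A/τd below.
  obtain ⟨c, hc0, hceq⟩ : ∃ c : ℝ, 0 < c ∧ 2 * c = C₃ - (C₃ + C₅) * (1 / τa) := by
    refine ⟨(C₃ - (C₃ + C₅) * (1 / τa)) / 2, ?_, by ring⟩
    have h6 : 0 ≤ 1 / (C₃ * τd) * Real.log (lyapunovRatio c₁ c₂) := by positivity
    have h7 : 1 / τa * (1 + C₅ / C₃) < 1 := by linarith
    have h8 : C₃ * (1 / τa * (1 + C₅ / C₃)) < C₃ * 1 := mul_lt_mul_of_pos_left h7 hC3
    have h9 : C₃ * (1 / τa * (1 + C₅ / C₃)) = (C₃ + C₅) * (1 / τa) := by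
      field_simp
    linarith
  have hp := hL.p_pos
  obtain ⟨A, hA0, hAeq⟩ : ∃ A : ℝ, 0 < A ∧ A * (1 / τd) = c :=
    ⟨c * τd, by positivity, by field_simp⟩
  -- The second bound is what ν k/T ≤ c/2 requires; ν vanishes exactly when ℓ does.
  set ν := min ℓ (c * T / (2 * k)) with hν
  have hν0 : 0 ≤ ν := le_min hℓ (by positivity)
  have hνc : ν * (k / T) ≤ c / 2 := by
    calc ν * (k / T) ≤ c * T / (2 * k) * (k / T) := by gcongr; exact min_le_right _ _
      _ = c / 2 := by field_simp
  set M := Real.exp (A * N₀ + (C₃ + C₅) * T₀)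
  set K := (C₂ * M + 2 * (C₄ * M) / c) / C₁ with hKdef
  have hM : 0 < M := Real.exp_pos _
  have hK : 0 < K := by positivity
  refine ⟨(2 * K) ^ (1 / p), c / (2 * p), A / p, ν / p, by positivity, by positivity, by positivity,
    by positivity, fun h => div_pos (lt_min h (by positivity)) hp,
    fun E z u h t j hmem U hU => ?_⟩
  have hσ0 := h.timeDilation_nonneg hT hk hmem
  have hσμ := h.one_add_timeDilation_le hT hk hmem
  have hσeq := h.omegaFun_snd hT hk hmem
  have hUn : 0 ≤ U := (norm_nonneg _).trans (hU _ ⟨t, j, hmem, le_rfl, le_rfl, rfl⟩)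
  have hC := h.mem_flowSet j t hmem
  obtain ⟨i, hi⟩ := hC.1.2.2
  have hW := hL.solution_estimate (ℓ := ℓ) (ν := ν) (A := A) (c := c) (C₂ := C₂) (C₃ := C₃)
    (C₄ := C₄) (C₅ := C₅) hT hk hA0.le hc0 hUn hC4.le hΔ (min_le_left _ _) hνc h2 h3 h4 h5
    (by positivity) (by linarith) h (t₀ := t) (j₀ := j)
    (fun t' j' h' ht' hj' => hU _ ⟨t', j', h', ht', hj', rfl⟩) j t hmem le_rfl le_rfl i hi.symm
  rw [hσeq] at hW
  set σ := timeDilation T k (z 0 0).snd t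
  have hbase : 0 ≤ k / T * σ := by positivity
  set φ := (1 + k / T * σ) ^ (-ν) with hφ
  have hφ0 : 0 < φ := Real.rpow_pos_of_pos (by linarith) _
  have hμφ : (z t j).snd ^ (-ν) ≤ φ :=
    Real.rpow_le_rpow_of_nonpos (by linarith) hσμ (by linarith)
  -- Half of the exponential rate is given up to extract φ from the transient, since (1 + y)^ν ≤
  -- exp(νy) and ν k/T ≤ c/2.
  have hexpφ : Real.exp (-(c * σ)) ≤ φ * Real.exp (-(c / 2 * σ)) := by
    have h6 : (1 + k / T * σ) ^ ν ≤ Real.exp (c / 2 * σ) := by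
      calc (1 + k / T * σ) ^ ν ≤ (Real.exp (k / T * σ)) ^ ν := by
            gcongr
            linarith [Real.add_one_le_exp (k / T * σ)]
        _ = Real.exp (ν * (k / T) * σ) := by rw [← Real.exp_mul]; ring_nf
        _ ≤ Real.exp (c / 2 * σ) := by gcongr
    rw [hφ, Real.rpow_neg (by linarith)]
    have h7 : Real.exp (-(c * σ)) = (Real.exp (c / 2 * σ))⁻¹ * Real.exp (-(c / 2 * σ)) := by
      rw [← Real.exp_neg, ← Real.exp_add]; ring_nf
    rw [h7]
    have h8 : 0 < (1 + k / T * σ) ^ ν := Real.rpow_pos_of_pos (by linarith) _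
    gcongr
  have hlow : C₁ * ‖(z t j).fst.x‖ ^ p ≤
      switchedLyapunov V A (C₃ + C₅) i (z t j).fst := by
    have h6 := (hL.bounds i (z t j).fst.x (z t j).fst.τ hC.1.1).1
    have h7 : C₁ * ‖(z t j).fst.x‖ ^ p ≤ c₁ i * ‖(z t j).fst.x‖ ^ p := by
      gcongr; exact h1 i
    have h8 : 0 ≤ (z t j).fst.τ := hC.1.1.1
    have h9 : 0 ≤ (z t j).fst.ρ := hC.1.2.1.1
    have h10 : 1 ≤ Real.exp (A * (z t j).fst.τ + (C₃ + C₅) * (z t j).fst.ρ) :=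
      Real.one_le_exp (by positivity)
    exact (h7.trans h6).trans (le_mul_of_one_le_right (hL.nonneg _ _ _ h8) h10)
  set x₀ := ‖(z 0 0).fst.x‖
  have hx₀ : 0 ≤ x₀ := norm_nonneg _
  have hpow : ‖(z t j).fst.x‖ ^ p ≤ K * φ *
      ((x₀ * Real.exp (-(c / (2 * p) * σ)) * Real.exp (-(A / p * j))) ^ p + U ^ p) := by
    have e1 : (x₀ * Real.exp (-(c / (2 * p) * σ)) * Real.exp (-(A / p * j))) ^ p =
        x₀ ^ p * Real.exp (-(c / 2 * σ)) * Real.exp (-(A * j)) := by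
      rw [Real.mul_rpow (by positivity) (by positivity), Real.mul_rpow (by positivity)
        (by positivity), ← Real.exp_mul, ← Real.exp_mul]
      congr 3 <;> field_simp
    rw [e1]
    have e2 : C₁ * ‖(z t j).fst.x‖ ^ p ≤ φ * Real.exp (-(c / 2 * σ)) * Real.exp (-(A * j)) *
        (C₂ * x₀ ^ p * M) + 2 * (C₄ * M * U ^ p) / c * φ := by
      refine (hlow.trans hW).trans ?_
      gcongr
    -- `K` adds the coefficients of the transient and of the input, so that one constant serves
    -- both; `e3` and `e4` are the surplus cross terms.
    have e3 : 0 ≤ 2 * (C₄ * M) / c * (φ * Real.exp (-(c / 2 * σ)) * Real.exp (-(A * j)) * x₀ ^ p) :=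
      by positivity
    have e4 : 0 ≤ C₂ * M * (φ * U ^ p) := by positivity
    have e5 : K * φ * (x₀ ^ p * Real.exp (-(c / 2 * σ)) * Real.exp (-(A * j)) + U ^ p) =
        ((C₂ * M + 2 * (C₄ * M) / c) *
          (φ * (x₀ ^ p * Real.exp (-(c / 2 * σ)) * Real.exp (-(A * j)) + U ^ p))) / C₁ := by
      rw [hKdef]; ring
    rw [e5, le_div_iff₀ hC1]
    have e6 : 2 * (C₄ * M * U ^ p) / c * φ = 2 * (C₄ * M) / c * (φ * U ^ p) := by ring
    rw [e6] at e2
    linarith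
  have hfin := le_of_rpow_le_mul_add hp hK.le hφ0.le (by positivity) hUn (norm_nonneg _) hpow
  have hφp : φ ^ (1 / p) = (1 + k / T * σ) ^ (-(ν / p)) := by
    rw [hφ, ← Real.rpow_mul (by linarith)]
    congr 1
    ring
  rw [hφp] at hfin
  refine hfin.trans_eq ?_
  ring

end Switched

theorem supInput_nonneg {U : Type*} [NormedAddCommGroup U] {E : Set (ℝ × ℕ)} (u : ℝ → ℕ → U)
    (t : ℝ) (j : ℕ) : 0 ≤ supInput E u t j :=
  Real.sSup_nonneg (by rintro a ⟨t', j', -, -, -, rfl⟩; exact norm_nonneg _)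

/-! ## Comparison functions -/

theorem isClassKL_mul_exp {C c : ℝ} (hC : 0 ≤ C) (hc : 0 < c) :
    IsClassKL (fun r t => C * r * Real.exp (-(c * t))) where
  nonneg r s hr _ := by positivity
  monotoneOn s _ r _ r' _ hrr' := by
    dsimp only
    gcongr
  antitoneOn r hr s _ s' _ hss' := by
    dsimp only
    gcongr
  tendsto_zero s _ := by
    have h : Continuous fun r : ℝ => C * r * Real.exp (-(c * s)) := by fun_prop
    have h1 := h.tendsto 0
    simp only [mul_zero, zero_mul] at h1
    exact h1.mono_left nhdsWithin_le_nhds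
  tendsto_atTop r _ := by
    have h : Tendsto (fun s : ℝ => Real.exp (-(c * s))) atTop (𝓝 0) :=
      Real.tendsto_exp_neg_atTop_nhds_zero.comp (tendsto_id.const_mul_atTop hc)
    simpa using h.const_mul (C * r)

theorem isClassKLL_mul_exp_mul_exp {C c A : ℝ} (hC : 0 ≤ C) (hc : 0 < c) (hA : 0 < A) :
    IsClassKLL (fun r s t => C * r * Real.exp (-(c * s)) * Real.exp (-(A * t))) := by
  intro s _
  constructor
  · convert! isClassKL_mul_exp (C := C * Real.exp (-(c * s))) (by positivity) hA using 3
    ring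
  · convert! isClassKL_mul_exp (C := C * Real.exp (-(A * s))) (by positivity) hc using 3
    ring

theorem isClassK_const_mul {C : ℝ} (hC : 0 < C) : IsClassK (fun r => C * r) where
  continuousOn := by fun_prop
  strictMonoOn _ _ _ _ h := mul_lt_mul_of_pos_left h hC
  map_zero := mul_zero C

theorem isClassKL_mul_rpow {b ν : ℝ} (hb : 0 < b) (hν : 0 < ν) :
    IsClassKL (fun r s => r * (1 + b * s) ^ (-ν)) where
  nonneg r s hr hs := by positivity
  monotoneOn s hs r _ r' _ hrr' := by
    have : (0 : ℝ) ≤ (1 + b * s) ^ (-ν) := by positivity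
    exact mul_le_mul_of_nonneg_right hrr' this
  antitoneOn r hr s hs s' _ hss' := by
    have hs0 : (0 : ℝ) ≤ s := hs
    refine mul_le_mul_of_nonneg_left ?_ hr
    exact Real.rpow_le_rpow_of_nonpos (by positivity) (by gcongr) (by linarith)
  tendsto_zero s _ := by
    have h1 : Tendsto (fun r : ℝ => r * (1 + b * s) ^ (-ν)) (𝓝 0) (𝓝 (0 * (1 + b * s) ^ (-ν))) :=
      tendsto_id.mul_const _
    rw [zero_mul] at h1
    exact h1.mono_left nhdsWithin_le_nhds
  tendsto_atTop r _ := by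
    have h : Tendsto (fun s : ℝ => 1 + b * s) atTop atTop :=
      tendsto_atTop_add_const_left _ _ (tendsto_id.const_mul_atTop hb)
    simpa using ((tendsto_rpow_neg_atTop hν).comp h).const_mul r

/-! ### The three stability statements -/

theorem theorem2 {N n m : ℕ}
    (f : Fin N → EuclideanSpace ℝ (Fin n) → EuclideanSpace ℝ (Fin m) → ℝ → ℝ →
      EuclideanSpace ℝ (Fin n))
    (R : Fin N → EuclideanSpace ℝ (Fin n) → EuclideanSpace ℝ (Fin n))
    (Qu : Set (Fin N)) (hQu : Qu.Nonempty)
    (τd τa N₀ T₀ : ℝ) (hτd : 0 < τd) (hτa : 1 < τa) (hN₀ : 1 ≤ N₀) (hT₀ : 0 ≤ T₀)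
    (hreg : RegularityAssumption f R)
    (V : Fin N → EuclideanSpace ℝ (Fin n) → ℝ → ℝ)
    (c₁ c₂ c₃ c₄ c₅ : Fin N → ℝ) (p χ : ℝ)
    (hcond : 1 > 1 / ((⨅ q, c₃ q) * τd) * Real.log (lyapunovRatio c₁ c₂)
      + 1 / τa * (1 + (⨆ q, c₅ q) / (⨅ q, c₃ q)))
    (T k : ℝ) (hT : 0 < T) (hk : 1 ≤ k) :
    (LyapunovAssumption f R Qu τd N₀ (fun _ => 0) V c₁ c₂ c₃ c₄ c₅ p χ →
      IsPTSF (switchedData f R Qu τd τa N₀ T₀) T k (switchedTarget N n N₀ T₀)) ∧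
    (LyapunovAssumption f R Qu τd N₀ (fun _ => 1) V c₁ c₂ c₃ c₄ c₅ p χ →
      IsPTISSF (switchedData f R Qu τd τa N₀ T₀) T k (switchedTarget N n N₀ T₀)) ∧
    (∀ ℓ : ℝ, 0 < ℓ →
      LyapunovAssumption f R Qu τd N₀ (fun μ => μ ^ (-ℓ)) V c₁ c₂ c₃ c₄ c₅ p χ →
      IsPTISSCF (switchedData f R Qu τd τa N₀ T₀) T k (switchedTarget N n N₀ T₀)) := by
  have hN : Nonempty (Fin N) := ⟨hQu.some⟩
  have hN0 : 0 ≤ N₀ := zero_le_one.trans hN₀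
  refine ⟨fun hL => ?_, fun hL => ?_, fun ℓ hℓ hL => ?_⟩
  -- The zero gain is below μ^0, so ℓ = 0 applies; the bound U = 0 removes the input term, and the
  -- remaining power is at most 1.
  · obtain ⟨C, c, A, ν, hC, hc, hA, hν, -, hest⟩ := hL.exists_norm_x_le (T := T) (k := k)
      (τa := τa) (T₀ := T₀) le_rfl hT hk hτd hN0 (fun μ _ => by simp) hcond
    refine ⟨_, isClassKLL_mul_exp_mul_exp hC.le hc hA, fun E z u h hu t j hmem => ?_⟩
    have h1 := hest E z u h t j hmem 0 (by
      rintro a ⟨t', j', h', -, -, rfl⟩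
      rw [hu t' j' h', norm_zero])
    have h2 := h.timeDilation_nonneg hT hk hmem
    rw [infDist_targetSet_eq (h.mem_flowSet j t hmem), infDist_targetSet_eq h.mem_flowSet_zero]
    rw [mul_zero, add_zero] at h1
    exact h1.trans (mul_le_of_le_one_right (by positivity)
      (Real.rpow_le_one_of_one_le_of_nonpos (le_add_of_nonneg_right (by positivity))
        (by linarith)))
  · obtain ⟨C, c, A, ν, hC, hc, hA, hν, -, hest⟩ := hL.exists_norm_x_le (T := T) (k := k)
      (τa := τa) (T₀ := T₀) le_rfl hT hk hτd hN0 (fun μ _ => by simp) hcond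
    refine ⟨_, _, isClassKLL_mul_exp_mul_exp hC.le hc hA, isClassK_const_mul hC,
      fun E z u h t j hmem hbdd => ?_⟩
    have h1 := hest E z u h t j hmem (supInput E u t j) fun a ha => le_csSup hbdd ha
    have h2 := h.timeDilation_nonneg hT hk hmem
    have h3 := supInput_nonneg (E := E) u t j
    rw [infDist_targetSet_eq (h.mem_flowSet j t hmem), infDist_targetSet_eq h.mem_flowSet_zero]
    exact h1.trans (mul_le_of_le_one_right (by positivity)
      (Real.rpow_le_one_of_one_le_of_nonpos (le_add_of_nonneg_right (by positivity))
        (by linarith)))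
  -- Now ν > 0, so the common factor tends to 0 and β_c(r, s) = r (1 + (k/T) s)^(-ν) is the
  -- convergence function.
  · obtain ⟨C, c, A, ν, hC, hc, hA, hν, hν', hest⟩ := hL.exists_norm_x_le (T := T) (k := k)
      (τa := τa) (T₀ := T₀) hℓ.le hT hk hτd hN0 (fun μ _ => le_rfl) hcond
    refine ⟨_, _, _, isClassKLL_mul_exp_mul_exp hC.le hc hA, isClassK_const_mul hC,
      isClassKL_mul_rpow (b := k / T) (by positivity) (hν' hℓ), fun E z u h t j hmem hbdd => ?_⟩
    have h1 := hest E z u h t j hmem (supInput E u t j) fun a ha => le_csSup hbdd ha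
    rw [infDist_targetSet_eq (h.mem_flowSet j t hmem), infDist_targetSet_eq h.mem_flowSet_zero]
    exact h1
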